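/- **Setting.** Fix $\lambda_t,C_d,C_r,d_0,d_{g,0},d_{r,0},m_h,m_r>0$, $p\in[0,1]$, an integer $N\ge1$, and path loss exponent $\alpha=4$. Put $\eta_{g}(d)=C_d d^{-\alpha}$, $\eta_{h}(d)=C_r(d_0d)^{-\alpha}$, $\eta_{g,0}=\eta_g(d_{g,0})$, $\eta_{h,0}=\eta_h(d_{r,0})$, $e_1=C_d+NC_rd_0^{-\alpha}$. *Fitted signal parameters.* Let $$c=\frac{\Gamma(m_h+\frac12)}{\Gamma(m_h)}\frac{\Gamma(m_r+\frac12)}{\Gamma(m_r)}\frac1{\sqrt{m_hm_r}},\quad a=Nc,\quad b=N+N(N-1)c^2,\quad \kappa_r=\frac{a^2}{b-a^2},\quad \omega_r=\frac{b-a^2}{a},$$ $\mu^g_q=\Gamma(1+\frac q2)$, $\mu^\varsigma_q=\omega_r^q\,\Gamma(q+\kappa_r)/\Gamma(\kappa_r)$, $\beta=\sqrt{\eta_{h,0}/\eta_{g,0}}$, $$\chi_1=\mu^g_2+2\beta\mu^g_1\mu^\varsigma_1+\beta^2\mu^\varsigma_2,\qquad \chi_2=\mu^g_4+4\beta\mu^g_3\mu^\varsigma_1+6\beta^2\mu^g_2\mu^\varsigma_2+4\beta^3\mu^g_1\mu^\varsigma_3+\beta^4\mu^\varsigma_4,$$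 $\kappa_s=\chi_1^2/(\chi_2-\chi_1^2)$, $\omega_s=\eta_{g,0}(\chi_2-\chi_1^2)/\chi_1$, and let $\hat\kappa_s$ be the positive integer nearest to $\kappa_s$ (a half-integer is rounded up). *Interference.* The interfering transmitters form a homogeneous Poisson point process $\{x_k\}$ of density $\lambda_t$ on $\mathbb R^2$; the user is at the origin and its serving transmitter is at the fixed distance $d_{g,0}$ (fixed association). Independently of the process and of each other over $k$, let $b_k\sim\mathrm{Bernoulli}(p)$ (presence of an assisting RIS), $g_k\sim\mathcal{CN}(0,1)$ and $w_k\sim\mathcal{CN}(0,N)$ be independent, and let $$I=\sum_k\Big|\sqrt{\eta_g(|x_k|)}\,g_k+b_k\sqrt{\eta_h(|x_k|)}\,w_k\Big|^2 .$$ (Here $w_k$ is the Gaussian approximation of the sum of the $N$ reflected paths, and the RIS of an interferer is taken to be at the same distance from the user as its transmitter.) *Signal and rate.* With an assisting RIS the signal power $S_0^+$ is (by moment matching and rounding of the shape) gamma distributed with shape $\hat\kappa_s$ and scale $\omega_s$; without one it is $S_0^*=\eta_{g,0}|g_0|^2$ with $g_0\sim\mathcal{CN}(0,1)$. Each is independent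 of the interferers' positions and of $(b_k,g_k,w_k)_k$. In the interference-limited scenario (no noise) the SINRs are $\gamma_0^+=S_0^+/I$ and $\gamma_0^*=S_0^*/I$, and the average achievable rate for SINR $\gamma$ with density $f_\gamma$ is $\int_0^\infty\log_2(1+x)f_\gamma(x)\,dx$. Let $\tilde R_1,\tilde R_2$ be the rates for $\gamma_0^+,\gamma_0^*$, respectively. **Corollary.** Both SINRs are almost surely positive and finite and have densities, both rate integrals converge, the function $V^+$ below is smooth at $s=1$, and $$\tilde R_1=\frac1{\ln2}\sum_{i=0}^{\hat\kappa_s-1}\frac{(-1)^i}{i!}\left[\frac{d^i}{ds^i}V^+(s)\right]_{s=1},\qquad \tilde R_2=\frac1{\ln2}\Big((\pi-2\,\mathrm{Si}(V_2))\sin V_2-2\,\mathrm{Ci}(V_2)\cos V_2\Big),$$ where $V^+(s)=(\pi-2\,\mathrm{Si}(V_1(s)))\sin V_1(s)-2\,\mathrm{Ci}(V_1(s))\cos V_1(s)$, $$V_1(s)=\frac{\pi^2}2\lambda_t\Big(p\sqrt{\tfrac{e_1s}{\omega_s}}+(1-p)\sqrt{\tfrac{C_ds}{\omega_s}}\Big),\qquad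 V_2=\frac{\pi^2}2\lambda_t\Big(p\sqrt{\tfrac{e_1}{\eta_{g,0}}}+(1-p)\sqrt{\tfrac{C_d}{\eta_{g,0}}}\Big),$$ $\mathrm{Si}(x)=\int_0^x\frac{\sin t}t\,dt$ and, for $x>0$, $\mathrm{Ci}(x)=-\int_x^\infty\frac{\cos t}t\,dt=\gamma_{E}+\ln x+\int_0^x\frac{\cos t-1}t\,dt$ with $\gamma_E$ the Euler–Mascheroni constant. -/

import Mathlib

open MeasureTheory ProbabilityTheory Set
open scoped ENNReal NNReal

noncomputable section

namespace RISNetwork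

/-! ### Special functions -/

/-- The sine integral `Si x = ∫₀ˣ (sin t) / t dt`. -/
def sinInt (x : ℝ) : ℝ := ∫ t in (0 : ℝ)..x, Real.sin t / t

/-- The cosine integral `Ci x = γ + log x + ∫₀ˣ (cos t - 1) / t dt` for `x > 0`
(`γ` is the Euler-Mascheroni constant); it equals `-∫ₓ^∞ (cos t) / t dt`. -/
def cosInt (x : ℝ) : ℝ :=
  Real.eulerMascheroniConstant + Real.log x + ∫ t in (0 : ℝ)..x, (Real.cos t - 1) / t

/-- `(π - 2 Si V) sin V - 2 Ci V cos V`. -/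
def rateFun (V : ℝ) : ℝ :=
  (Real.pi - 2 * sinInt V) * Real.sin V - 2 * cosInt V * Real.cos V

/-! ### Parameters of the network -/

/-- Deterministic parameters: TX density `lam`, probability `p` that a TX has an assisting RIS,
path loss constants `Cd` (direct) and `Cr` (reflected), path loss exponent `α`, TX-RIS distance
`d0`, number `N` of elements per RIS, Nakagami shape parameters `mh`, `mr`, and the distances
`dg0`, `dr0` from the typical user to its serving TX and to the RIS of that TX. -/
structure Params where
  lam : ℝ
  p : ℝ
  Cd : ℝ
  Cr : ℝ
  α : ℝ
  d0 : ℝ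
  N : ℕ
  mh : ℝ
  mr : ℝ
  dg0 : ℝ
  dr0 : ℝ
  lam_pos : 0 < lam
  p_nonneg : 0 ≤ p
  p_le_one : p ≤ 1
  Cd_pos : 0 < Cd
  Cr_pos : 0 < Cr
  d0_pos : 0 < d0
  N_pos : 0 < N
  mh_pos : 0 < mh
  mr_pos : 0 < mr
  dg0_pos : 0 < dg0
  dr0_pos : 0 < dr0

namespace Params

variable (θ : Params)

/-- Path loss of a direct link of length `d`. -/
def directLoss (d : ℝ) : ℝ := θ.Cd * d ^ (-θ.α)

/-- Path loss of a reflected link whose RIS is at distance `d` from the user. -/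
def reflectedLoss (d : ℝ) : ℝ := θ.Cr * (θ.d0 * d) ^ (-θ.α)

/-- `η_{g,0}`. -/
def etaG0 : ℝ := θ.directLoss θ.dg0

/-- `η_{h,0}`. -/
def etaH0 : ℝ := θ.reflectedLoss θ.dr0

/-- `e₁ = C_d + N C_r d₀^{-α}`. -/
def e1 : ℝ := θ.Cd + θ.N * θ.Cr * θ.d0 ^ (-θ.α)

/-! Moment matching for `S_r = ∑ₙ |hₙ| |rₙ|`, with `|hₙ| ~ Nakagami(m_h, 1)` and
`|rₙ| ~ Nakagami(m_r, 1)` independent, and for the signal power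
`(√η_{g,0} |g₀| + √η_{h,0} S_r)²`. -/

/-- `E[|hₙ| |rₙ|]`. -/
def meanHR : ℝ :=
  Real.Gamma (θ.mh + 1 / 2) / Real.Gamma θ.mh * (Real.Gamma (θ.mr + 1 / 2) / Real.Gamma θ.mr) *
    √(1 / (θ.mh * θ.mr))

/-- `E[S_r]`. -/
def meanSr : ℝ := θ.N * θ.meanHR

/-- `E[S_r²]`. -/
def secondSr : ℝ := θ.N + θ.N * ((θ.N : ℝ) - 1) * θ.meanHR ^ 2

/-- Shape of the gamma law fitted to `S_r`. -/
def kappaR : ℝ := θ.meanSr ^ 2 / (θ.secondSr - θ.meanSr ^ 2)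

/-- Scale of the gamma law fitted to `S_r`. -/
def omegaR : ℝ := (θ.secondSr - θ.meanSr ^ 2) / θ.meanSr

/-- `q`-th moment of the Rayleigh amplitude `|g₀|`. -/
def muG (q : ℕ) : ℝ := Real.Gamma (1 + (q : ℝ) / 2)

/-- `q`-th moment of the gamma law fitted to `S_r`. -/
def muS (q : ℕ) : ℝ := θ.omegaR ^ q * Real.Gamma (q + θ.kappaR) / Real.Gamma θ.kappaR

def beta : ℝ := √(θ.etaH0 / θ.etaG0)

/-- First moment of `(|g₀| + β S_r)²`. -/
def chi1 : ℝ := muG 2 + 2 * θ.beta * muG 1 * θ.muS 1 + θ.beta ^ 2 * θ.muS 2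

/-- Second moment of `(|g₀| + β S_r)²`. -/
def chi2 : ℝ :=
  muG 4 + 4 * θ.beta * muG 3 * θ.muS 1 + 6 * θ.beta ^ 2 * muG 2 * θ.muS 2 +
    4 * θ.beta ^ 3 * muG 1 * θ.muS 3 + θ.beta ^ 4 * θ.muS 4

/-- Shape of the gamma law fitted to the signal power. -/
def kappaS : ℝ := θ.chi1 ^ 2 / (θ.chi2 - θ.chi1 ^ 2)

/-- Scale of the gamma law fitted to the signal power. -/
def omegaS : ℝ := θ.etaG0 * ((θ.chi2 - θ.chi1 ^ 2) / θ.chi1)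

/-- The positive integer nearest to `kappaS`. -/
def kappaHat : ℕ := max 1 (round θ.kappaS).toNat

def V1 (s : ℝ) : ℝ :=
  Real.pi ^ 2 / 2 * θ.lam * (θ.p * √(θ.e1 / θ.omegaS * s) + (1 - θ.p) * √(θ.Cd / θ.omegaS * s))

def V2 : ℝ :=
  Real.pi ^ 2 / 2 * θ.lam * (θ.p * √(θ.e1 / θ.etaG0) + (1 - θ.p) * √(θ.Cd / θ.etaG0))

def Vplus (s : ℝ) : ℝ := rateFun (θ.V1 s)

end Params

/-! ### The random network -/

/-- The plane with its Euclidean norm and Lebesgue measure. -/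
abbrev Plane : Type := EuclideanSpace ℝ (Fin 2)

/-- The circularly symmetric complex Gaussian law `CN(0, v)`. -/
def complexNormal (v : ℝ≥0) : Measure ℂ :=
  ((gaussianReal 0 (v / 2)).prod (gaussianReal 0 (v / 2))).map (fun z => (⟨z.1, z.2⟩ : ℂ))

/-- The Bernoulli law on `Bool` with success probability `p`. -/
def coinLaw (p : ℝ) : Measure Bool :=
  ENNReal.ofReal p • Measure.dirac true + ENNReal.ofReal (1 - p) • Measure.dirac false

variable {Ω : Type*} [MeasurableSpace Ω]

/-- Number of indices `k` with `X k ω ∈ A`. -/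
def pointCount (X : ℕ → Ω → Plane) (A : Set Plane) (ω : Ω) : ℝ≥0∞ :=
  ∑' k, A.indicator (fun _ => (1 : ℝ≥0∞)) (X k ω)

/-- `X` enumerates a homogeneous Poisson point process on the plane with density `lam`. -/
structure IsHPPP (lam : ℝ) (X : ℕ → Ω → Plane) (P : Measure Ω) : Prop where
  measurable : ∀ k, Measurable (X k)
  hasLaw : ∀ A : Set Plane, MeasurableSet A → volume A ≠ ∞ →
    HasLaw (pointCount X A)
      ((poissonMeasure (ENNReal.ofReal lam * volume A).toNNReal).map
        (fun n : ℕ => (n : ℝ≥0∞))) P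
  indep : ∀ (n : ℕ) (A : Fin n → Set Plane), (∀ i, MeasurableSet (A i)) →
    (∀ i, volume (A i) ≠ ∞) → (∀ i j, i ≠ j → Disjoint (A i) (A j)) →
    iIndepFun (fun i => pointCount X (A i)) P

/-- The mark of an interfering TX: whether it has an assisting RIS, its direct fading coefficient,
and the aggregate fading coefficient of its reflected link. -/
abbrev Mark : Type := Bool × ℂ × ℂ

/-- The interferers: TX positions `X` form a homogeneous Poisson process, and they carry i.i.d.
marks, independent of the positions. In a mark, the three components are independent: a
Bernoulli(`p`) variable, a `CN(0, 1)` coefficient (Rayleigh fading), and a `CN(0, N)` coefficient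
(the Gaussian approximation of the sum over the `N` RIS elements). -/
structure IsInterferers (θ : Params) (X : ℕ → Ω → Plane) (M : ℕ → Ω → Mark) (P : Measure Ω) :
    Prop where
  hppp : IsHPPP θ.lam X P
  measurable_mark : ∀ k, Measurable (M k)
  hasLaw_mark : ∀ k,
    HasLaw (M k) ((coinLaw θ.p).prod ((complexNormal 1).prod (complexNormal θ.N))) P
  iIndep_mark : iIndepFun M P
  indep : IndepFun (fun ω k => X k ω) (fun ω k => M k ω) P

/-- Received interference power from a TX at `x` with mark `m`; the RIS of an interfering TX is
taken to be at the same distance from the user as the TX itself. -/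
def interfererPower (θ : Params) (x : Plane) (m : Mark) : ℝ :=
  if m.1 then
    ‖((√(θ.directLoss ‖x‖) : ℝ) : ℂ) * m.2.1 + ((√(θ.reflectedLoss ‖x‖) : ℝ) : ℂ) * m.2.2‖ ^ 2
  else ‖((√(θ.directLoss ‖x‖) : ℝ) : ℂ) * m.2.1‖ ^ 2

/-- Total interference power at the typical user, located at the origin. -/
def interference (θ : Params) (X : ℕ → Ω → Plane) (M : ℕ → Ω → Mark) (ω : Ω) : ℝ :=
  ∑' k, interfererPower θ (X k ω) (M k ω)

/-- SINR with signal power `S`, interference power `I` and inverse transmit SNR `ν`. -/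
def sinr (S I : Ω → ℝ) (ν : ℝ) (ω : Ω) : ℝ := S ω / (I ω + ν)

/-- Signal power when the serving TX has no RIS and its fading coefficient is `g`. -/
def signalDirect (θ : Params) (g : Ω → ℂ) (ω : Ω) : ℝ := θ.etaG0 * ‖g ω‖ ^ 2

/-- `∫₀^∞ log₂(1 + x) f_γ(x) dx`, where `f_γ` is the density of `γ`. -/
def averageRate (γ : Ω → ℝ) (P : Measure Ω) : ℝ :=
  ∫ x in Ioi (0 : ℝ), Real.logb 2 (1 + x) * (pdf γ P volume x).toReal

/-- The integral defining the average rate is meaningful: `γ` has a density, is almost surely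
positive (so the interference series, whose non-summable value would be `0`, converges to a positive
number), and the integrand is integrable. -/
structure RateWellDefined (γ : Ω → ℝ) (P : Measure Ω) : Prop where
  hasPDF : HasPDF γ P volume
  pos : ∀ᵐ ω ∂P, 0 < γ ω
  integrable :
    IntegrableOn (fun x => Real.logb 2 (1 + x) * (pdf γ P volume x).toReal) (Ioi (0 : ℝ)) volume

end RISNetwork

end

namespace RISNetwork

open Filter Topology

/-! The interference `I` has the explicit Laplace transform `E e^{-sI} = e^{-K√s}`, where `K` is
`laplaceCoeff`. This is the law of a positive stable variable of index 1/2. By the Laplace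
functional of a marked Poisson process (`IsHPPP.lintegral_expNeg_tsum_marked`), minus the logarithm
of the transform is the density times the plane integral of one minus the transform of a single
interferer's power. Conditionally on the RIS indicator that power is the squared modulus of a
circular Gaussian, hence exponential with mean `A |x|⁻⁴`, where `A` is `e1` or `Cd`. In polar
coordinates `∫ (1 - 1/(1 + s A |x|⁻⁴)) dx = (π²/2) √(sA)`. The series is first summed in `[0, ∞]`.
Letting `s → 0` and `s → ∞` in the transform then shows that `I` is almost surely finite and
positive.

For a signal `S` with integer gamma shape `k` and rate `r`, independent of `I`, the layer-cake
formula gives `E log(1 + S/I) = ∫₀^∞ P(S > tI) dt/(1+t)`, and the tail is `P(S > y) = ∑_{i<k} (ry)ⁱ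
e^{-ry} / i!`. Set `Y = -r t I` on the product of `P` with `dt/(1+t)`. The `i`-th summand is then
`(-1)ⁱ/i!` times the integral of `Yⁱ e^Y`, which is the `i`-th derivative at `s = 1` of the moment
generating function of `Y`. By Fubini that function is `∫₀^∞ e^{-K√(rst)} dt/(1+t)`, so the formula,
the convergence and the smoothness all follow from analyticity of moment generating functions
(`integral_erlangTail_prod_rateMeasure`).

The closed form comes from `t = u²`, which turns the integral into `2 ∫ u e^{-Vu}/(1+u²) du`. This
integral and its companion without the factor `u` solve the same linear differential system as the
Si/Ci expressions, with the same behaviour at `0+` (`two_mul_auxInt_one`); Euler's constant enters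
there as `-∫ log x e^{-x} dx`.

The direct signal is exponential, that is, the case `k = 1`. It remains to check that the fitted
scale `omegaS` is positive. This rests on log-convexity of Gamma and on `π ≤ 4`. -/

/-! ### The auxiliary functions of the sine and cosine integrals -/

/-- The integral `∫₀^∞ uⁿ e^{-Vu} / (1 + u²) du`. -/
noncomputable def auxInt (n : ℕ) (V : ℝ) : ℝ :=
  ∫ u in Ioi (0 : ℝ), u ^ n * Real.exp (-V * u) * (1 + u ^ 2)⁻¹

lemma integrableOn_pow_mul_exp_neg (n : ℕ) {V : ℝ} (hV : 0 < V) :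
    IntegrableOn (fun u : ℝ => u ^ n * Real.exp (-V * u)) (Ioi 0) := by
  have h := integrableOn_rpow_mul_exp_neg_mul_rpow (p := 1) (s := n) (b := V)
    (by linarith [Nat.cast_nonneg (α := ℝ) n]) one_pos hV
  simpa using h

lemma inv_one_add_sq_le_one (u : ℝ) : (1 + u ^ 2)⁻¹ ≤ 1 :=
  inv_le_one_of_one_le₀ (by nlinarith [sq_nonneg u])

lemma integrableOn_auxInt (n : ℕ) {V : ℝ} (hV : 0 < V) :
    IntegrableOn (fun u : ℝ => u ^ n * Real.exp (-V * u) * (1 + u ^ 2)⁻¹) (Ioi 0) := by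
  refine (integrableOn_pow_mul_exp_neg n hV).mono' (Measurable.aestronglyMeasurable (by fun_prop)) ?_
  filter_upwards [ae_restrict_mem measurableSet_Ioi] with u hu
  have hu : 0 < u := hu
  rw [Real.norm_of_nonneg (by positivity)]
  exact mul_le_of_le_one_right (by positivity) (inv_one_add_sq_le_one u)

lemma hasDerivAt_auxInt (n : ℕ) {V : ℝ} (hV : 0 < V) :
    HasDerivAt (auxInt n) (-auxInt (n + 1) V) V := by
  have h := hasDerivAt_integral_of_dominated_loc_of_deriv_le
    (μ := volume.restrict (Ioi (0 : ℝ)))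
    (F := fun (W u : ℝ) => u ^ n * Real.exp (-W * u) * (1 + u ^ 2)⁻¹)
    (F' := fun (W u : ℝ) => -(u ^ (n + 1) * Real.exp (-W * u) * (1 + u ^ 2)⁻¹))
    -- Staying above `V / 2` keeps the exponential decay uniform in the parameter.
    (x₀ := V) (s := Ioi (V / 2)) (bound := fun u => u ^ (n + 1) * Real.exp (-(V / 2) * u))
    (Ioi_mem_nhds (by linarith))
    (Eventually.of_forall fun W => Measurable.aestronglyMeasurable (by fun_prop))
    (integrableOn_auxInt n hV) (Measurable.aestronglyMeasurable (by fun_prop)) ?_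
    (integrableOn_pow_mul_exp_neg (n + 1) (by linarith)) ?_
  · have h2 := h.2
    rw [integral_neg] at h2
    exact h2
  · filter_upwards [ae_restrict_mem measurableSet_Ioi] with u hu W hW
    have hu : 0 < u := hu
    have hW : V / 2 < W := hW
    rw [norm_neg, Real.norm_of_nonneg (by positivity)]
    refine (mul_le_of_le_one_right (by positivity) (inv_one_add_sq_le_one u)).trans ?_
    gcongr
  · filter_upwards with u W _
    have h1 : HasDerivAt (fun W : ℝ => Real.exp (-W * u)) (Real.exp (-W * u) * (-1 * u)) W :=
      (((hasDerivAt_id W).neg).mul_const u).exp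
    exact ((h1.const_mul (u ^ n)).mul_const ((1 + u ^ 2)⁻¹)).congr_deriv (by ring)

/-- Since `u² = (1 + u²) - 1`, the second derivative of `auxInt 0` is again expressed through
`auxInt 0`, which closes the differential system. -/
lemma auxInt_two {V : ℝ} (hV : 0 < V) : auxInt 2 V = 1 / V - auxInt 0 V := by
  have h : auxInt 2 V + auxInt 0 V = ∫ u in Ioi (0 : ℝ), Real.exp (-V * u) := by
    rw [auxInt, auxInt, ← integral_add (integrableOn_auxInt 2 hV) (integrableOn_auxInt 0 hV)]
    congr 1 with u
    have : (1 + u ^ 2 : ℝ) ≠ 0 := by positivity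
    field_simp
    ring
  rw [integral_exp_mul_Ioi (by linarith)] at h
  simp only [mul_zero, Real.exp_zero] at h
  rw [eq_sub_iff_add_eq, h]
  field_simp

/-! ### Derivatives of Si and Ci, and their behaviour at `0+` -/

lemma intervalIntegrable_of_norm_le {f : ℝ → ℝ} (hf : Measurable f) {a b C : ℝ}
    (h : ∀ x ∈ Set.uIoc a b, ‖f x‖ ≤ C) : IntervalIntegrable f volume a b := by
  rw [intervalIntegrable_iff]
  refine Measure.integrableOn_of_bounded (M := C) (by simp) hf.aestronglyMeasurable ?_
  exact (ae_restrict_iff' measurableSet_uIoc).2 (Eventually.of_forall h)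

lemma norm_sin_div_le (t : ℝ) : ‖Real.sin t / t‖ ≤ 1 := by
  rw [norm_div]
  exact div_le_one_of_le₀ Real.abs_sin_le_abs (norm_nonneg t)

lemma norm_cos_sub_one_div_le (t : ℝ) : ‖(Real.cos t - 1) / t‖ ≤ |t| := by
  rcases eq_or_ne t 0 with rfl | ht
  · simp
  rw [norm_div, Real.norm_eq_abs, Real.norm_eq_abs, div_le_iff₀ (abs_pos.2 ht), abs_mul_abs_self,
    abs_le]
  constructor <;> nlinarith [Real.one_sub_sq_div_two_le_cos (x := t), Real.cos_le_one t, sq_nonneg t]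

lemma hasDerivAt_sinInt {x : ℝ} (hx : 0 < x) : HasDerivAt sinInt (Real.sin x / x) x := by
  refine intervalIntegral.integral_hasDerivAt_right
    (intervalIntegrable_of_norm_le (by fun_prop) fun t _ => norm_sin_div_le t)
    (Measurable.stronglyMeasurable (by fun_prop)).stronglyMeasurableAtFilter ?_
  exact Real.continuous_sin.continuousAt.div continuousAt_id hx.ne'

/-- The integral `∫₀ˣ (cos t - 1) / t dt`. -/
noncomputable def cosSubOneInt (x : ℝ) : ℝ := ∫ t in (0 : ℝ)..x, (Real.cos t - 1) / t

lemma hasDerivAt_cosSubOneInt {x : ℝ} (hx : 0 < x) :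
    HasDerivAt cosSubOneInt ((Real.cos x - 1) / x) x := by
  refine intervalIntegral.integral_hasDerivAt_right
    (intervalIntegrable_of_norm_le (C := x) (by fun_prop) fun t ht => ?_)
    (Measurable.stronglyMeasurable (by fun_prop)).stronglyMeasurableAtFilter ?_
  · refine (norm_cos_sub_one_div_le t).trans ?_
    rw [uIoc_of_le hx.le] at ht
    rw [abs_of_pos ht.1]
    exact ht.2
  · exact (Real.continuous_cos.continuousAt.sub continuousAt_const).div continuousAt_id hx.ne'

lemma hasDerivAt_cosInt {x : ℝ} (hx : 0 < x) : HasDerivAt cosInt (Real.cos x / x) x := by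
  have h := ((Real.hasDerivAt_log hx.ne').const_add Real.eulerMascheroniConstant).add
    (hasDerivAt_cosSubOneInt hx)
  refine h.congr_deriv ?_
  field_simp
  ring

lemma tendsto_sinInt_zero : Tendsto sinInt (𝓝[>] 0) (𝓝 0) := by
  refine squeeze_zero_norm (a := fun x => |x|) (fun x => ?_) ?_
  · simpa [sinInt] using intervalIntegral.norm_integral_le_of_norm_le_const (a := 0) (b := x)
      fun t _ => norm_sin_div_le t
  · exact (continuous_abs.tendsto' 0 0 abs_zero).mono_left nhdsWithin_le_nhds

lemma tendsto_cosSubOneInt_zero : Tendsto cosSubOneInt (𝓝[>] 0) (𝓝 0) := by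
  refine squeeze_zero_norm (a := fun x => |x| * |x|) (fun x => ?_) ?_
  · have h := intervalIntegral.norm_integral_le_of_norm_le_const (a := 0) (b := x) (C := |x|)
      (f := fun t => (Real.cos t - 1) / t) fun t ht => by
        refine (norm_cos_sub_one_div_le t).trans ?_
        rcases le_total 0 x with h | h
        · rw [uIoc_of_le h] at ht
          exact abs_le_abs_of_nonneg ht.1.le ht.2
        · rw [uIoc_of_ge h] at ht
          exact abs_le_abs_of_nonpos ht.2 ht.1.le
    simpa [cosSubOneInt] using h
  · exact ((continuous_abs.mul continuous_abs).tendsto' 0 0 (by simp)).mono_left nhdsWithin_le_nhds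

/-- Disposes of the logarithmic singularity of Ci at `0` when it is multiplied by `sin x` or `1 -
cos x`. -/
lemma tendsto_log_mul_zero {h : ℝ → ℝ} (hh : ∀ x, |h x| ≤ |x|) :
    Tendsto (fun x => Real.log x * h x) (𝓝[>] 0) (𝓝 0) := by
  refine squeeze_zero_norm (a := fun x => |x * Real.log x|) (fun x => ?_) ?_
  · rw [Real.norm_eq_abs, abs_mul, abs_mul, mul_comm]
    exact mul_le_mul_of_nonneg_right (hh x) (abs_nonneg _)
  · exact ((Real.continuous_mul_log.abs).tendsto' 0 0 (by simp)).mono_left nhdsWithin_le_nhds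

lemma abs_one_sub_cos_le (x : ℝ) : |1 - Real.cos x| ≤ |x| := by
  have h1 : |1 - Real.cos x| ≤ 2 * |Real.sin (x / 2)| := by
    have : 1 - Real.cos x = 2 * Real.sin (x / 2) ^ 2 := by
      rw [Real.sin_sq_eq_half_sub]; ring_nf
    rw [this, abs_mul, abs_pow, abs_two]
    nlinarith [Real.abs_sin_le_one (x / 2), abs_nonneg (Real.sin (x / 2))]
  have h2 := Real.abs_sin_le_abs (x := x / 2)
  rw [abs_div, abs_two] at h2
  linarith

/-! ### The Euler-Mascheroni constant as a logarithmic moment -/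

/-- Gamma is the Mellin transform of `e^{-t}`. Differentiating under the integral at `1` produces
the factor `log t`, and `Γ'(1) = -γ`. -/
lemma integrableOn_log_mul_exp_neg_and_integral :
    IntegrableOn (fun x : ℝ => Real.log x * Real.exp (-x)) (Ioi 0) ∧
    ∫ x in Ioi (0 : ℝ), Real.log x * Real.exp (-x) = -Real.eulerMascheroniConstant := by
  -- The exponents `a = 2` and `b = 0` bound `e^{-t}` at infinity and at `0`; the point `s = 1` lies
  -- strictly between them.
  have key := mellin_hasDerivAt_of_isBigO_rpow (E := ℂ) (f := fun t : ℝ => (Real.exp (-t) : ℂ))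
    (a := 2) (b := 0) (s := 1) ?_ ?_ (by norm_num) ?_ (by norm_num)
  · have hint := key.1
    have hder := key.2
    rw [MellinConvergent] at hint
    have e1 : ∀ t : ℝ, ((t : ℂ) ^ ((1 : ℂ) - 1) • (Real.log t • (Real.exp (-t) : ℂ)))
        = ((Real.log t * Real.exp (-t) : ℝ) : ℂ) := by
      intro t; simp
    simp_rw [e1] at hint
    have hI : IntegrableOn (fun x : ℝ => Real.log x * Real.exp (-x)) (Ioi 0) := by
      have := hint.re
      simp only [RCLike.re_to_complex, Complex.ofReal_re] at this
      exact this
    refine ⟨hI, ?_⟩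
    have hg : HasDerivAt Complex.Gamma (-(Real.eulerMascheroniConstant : ℂ)) 1 :=
      Complex.hasDerivAt_Gamma_one
    have hg2 : HasDerivAt Complex.Gamma
        (mellin (fun t : ℝ => Real.log t • (Real.exp (-t) : ℂ)) 1) 1 := by
      refine hder.congr_of_eventuallyEq ?_
      have ho : IsOpen {s : ℂ | 0 < s.re} := isOpen_lt continuous_const Complex.continuous_re
      filter_upwards [ho.mem_nhds (show (0 : ℝ) < (1 : ℂ).re by simp)] with s hs
      rw [Complex.Gamma_eq_integral hs, Complex.GammaIntegral_eq_mellin]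
    have huniq := hg2.unique hg
    rw [mellin] at huniq
    simp_rw [e1] at huniq
    rw [integral_complex_ofReal] at huniq
    exact_mod_cast huniq
  · exact (Continuous.continuousOn (by fun_prop)).locallyIntegrableOn measurableSet_Ioi
  · rw [← Asymptotics.isBigO_norm_left]
    simp_rw [Complex.norm_real, Asymptotics.isBigO_norm_left]
    simpa only [neg_one_mul] using (isLittleO_exp_neg_mul_rpow_atTop zero_lt_one _).isBigO
  · simp_rw [neg_zero, Real.rpow_zero]
    refine Asymptotics.isBigO_const_of_tendsto (?_ : Tendsto _ _ (𝓝 (1 : ℂ))) one_ne_zero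
    rw [(by simp : (1 : ℂ) = (Real.exp (-0) : ℂ))]
    exact (Continuous.continuousWithinAt (by fun_prop))

/-! ### The auxiliary functions in terms of the sine and cosine integrals -/

lemma log_one_add_sq_nonneg (u : ℝ) : 0 ≤ Real.log (1 + u ^ 2) :=
  Real.log_nonneg (by nlinarith [sq_nonneg u])

lemma log_one_add_sq_le (u : ℝ) : Real.log (1 + u ^ 2) ≤ u ^ 2 := by
  have := Real.log_le_sub_one_of_pos (x := 1 + u ^ 2) (by positivity)
  linarith

lemma integrableOn_exp_mul_log_one_add_sq {V : ℝ} (hV : 0 < V) :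
    IntegrableOn (fun u : ℝ => Real.exp (-V * u) * Real.log (1 + u ^ 2)) (Ioi 0) := by
  refine (integrableOn_pow_mul_exp_neg 2 hV).mono' (Measurable.aestronglyMeasurable (by fun_prop)) ?_
  filter_upwards with u
  rw [Real.norm_of_nonneg (mul_nonneg (Real.exp_pos _).le (log_one_add_sq_nonneg u)), mul_comm]
  gcongr
  exact log_one_add_sq_le u

/-- Integration by parts with primitive `log(1 + u²)/2` of `u/(1 + u²)`; the boundary terms vanish
at both ends. -/
lemma auxInt_one_eq_integral_log {V : ℝ} (hV : 0 < V) :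
    auxInt 1 V = ∫ u in Ioi (0 : ℝ), V * (Real.exp (-V * u) * Real.log (1 + u ^ 2) / 2) := by
  have hd : ∀ u : ℝ, HasDerivAt (fun u : ℝ => Real.exp (-V * u) * Real.log (1 + u ^ 2) / 2)
      (u ^ 1 * Real.exp (-V * u) * (1 + u ^ 2)⁻¹
        - V * (Real.exp (-V * u) * Real.log (1 + u ^ 2) / 2)) u := by
    intro u
    have h1 : HasDerivAt (fun u : ℝ => Real.exp (-V * u)) (Real.exp (-V * u) * (-V * 1)) u :=
      ((hasDerivAt_id u).const_mul (-V)).exp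
    have h2 : HasDerivAt (fun u : ℝ => Real.log (1 + u ^ 2)) ((2 * u) / (1 + u ^ 2)) u := by
      have h3 : HasDerivAt (fun u : ℝ => 1 + u ^ 2) (2 * u) u := by
        simpa using (hasDerivAt_pow 2 u).const_add 1
      exact h3.log (by positivity)
    refine ((h1.mul h2).div_const 2).congr_deriv ?_
    have : (1 + u ^ 2 : ℝ) ≠ 0 := by positivity
    field_simp
    ring
  have hi2 := ((integrableOn_exp_mul_log_one_add_sq hV).div_const 2).const_mul V
  have hi1 := integrableOn_auxInt 1 hV
  have key := integral_Ioi_of_hasDerivAt_of_tendsto (a := 0) (m := 0)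
    (hd 0).continuousAt.continuousWithinAt (fun u _ => hd u) (hi1.sub hi2) ?_
  · rw [integral_sub hi1 hi2] at key
    have h0 : auxInt 1 V - ∫ u in Ioi (0 : ℝ), V * (Real.exp (-V * u) * Real.log (1 + u ^ 2) / 2)
      = 0 := by rw [auxInt, key]; simp
    linarith
  · have hlim : Tendsto (fun u : ℝ => u ^ 2 * Real.exp (-V * u)) atTop (𝓝 0) := by
      have := Real.tendsto_pow_mul_exp_neg_atTop_nhds_zero 2
      have h2 := (this.comp (tendsto_id.const_mul_atTop hV)).const_mul (V ^ 2)⁻¹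
      rw [mul_zero] at h2
      refine h2.congr fun u => ?_
      simp only [Function.comp, id]
      field_simp
    refine squeeze_zero (fun u => ?_) (fun u => ?_) hlim
    · have := mul_nonneg (Real.exp_pos (-V * u)).le (log_one_add_sq_nonneg u)
      positivity
    · have := mul_le_mul_of_nonneg_left (log_one_add_sq_le u) (Real.exp_pos (-V * u)).le
      have := mul_nonneg (Real.exp_pos (-V * u)).le (log_one_add_sq_nonneg u)
      linarith

lemma integral_exp_neg_Ioi_one : ∫ x in Ioi (0 : ℝ), Real.exp (-x) = 1 := by
  simpa using integral_exp_neg_Ioi 0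

/-- Rescaling by `x = Vu` and writing `log V` as `∫ log V e^{-x} dx` cancels the divergence at `V =
0`. The limit can then be taken under the integral. -/
lemma auxInt_one_add_log {V : ℝ} (hV : 0 < V) :
    auxInt 1 V + Real.log V
      = ∫ x in Ioi (0 : ℝ), Real.exp (-x) * (Real.log (V ^ 2 + x ^ 2) / 2) := by
  have h1 := integral_comp_mul_left_Ioi
    (fun x : ℝ => Real.exp (-x) * Real.log (1 + (x / V) ^ 2) / 2) 0 hV
  rw [mul_zero] at h1
  have hint : IntegrableOn (fun x : ℝ => Real.exp (-x) * Real.log (1 + (x / V) ^ 2) / 2) (Ioi 0) := by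
    have h := (integrableOn_exp_mul_log_one_add_sq hV).div_const 2
    have h' := (integrableOn_Ioi_comp_mul_left_iff
      (fun x : ℝ => Real.exp (-x) * Real.log (1 + (x / V) ^ 2) / 2) 0 hV).1
    rw [mul_zero] at h'
    apply h'
    refine IntegrableOn.congr_fun h (fun u _ => ?_) measurableSet_Ioi
    have : V * u / V = u := by field_simp
    simp only [this, neg_mul]
  have h2 : auxInt 1 V = ∫ x in Ioi (0 : ℝ), Real.exp (-x) * Real.log (1 + (x / V) ^ 2) / 2 := by
    rw [auxInt_one_eq_integral_log hV, integral_const_mul]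
    have h3 : ∀ u : ℝ, V * u / V = u := fun u => by field_simp
    simp only [h3] at h1
    simp only [neg_mul]
    rw [h1, smul_eq_mul]
    field_simp
  have h4 : Real.log V = ∫ x in Ioi (0 : ℝ), Real.log V * Real.exp (-x) := by
    rw [integral_const_mul, integral_exp_neg_Ioi_one, mul_one]
  rw [h2, h4, ← integral_add hint ((integrableOn_exp_neg_Ioi 0).const_mul _)]
  refine setIntegral_congr_fun measurableSet_Ioi fun x hx => ?_
  have hx : 0 < x := hx
  have : V ^ 2 + x ^ 2 = V ^ 2 * (1 + (x / V) ^ 2) := by field_simp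
  rw [this, Real.log_mul (by positivity) (by positivity), Real.log_pow]
  push_cast
  ring

lemma tendsto_auxInt_one_add_log :
    Tendsto (fun V => auxInt 1 V + Real.log V) (𝓝[>] 0) (𝓝 (-Real.eulerMascheroniConstant)) := by
  have hlogint := integrableOn_log_mul_exp_neg_and_integral
  have h : Tendsto (fun V : ℝ => ∫ x in Ioi (0 : ℝ), Real.exp (-x) * (Real.log (V ^ 2 + x ^ 2) / 2))
      (𝓝[>] 0) (𝓝 (∫ x in Ioi (0 : ℝ), Real.log x * Real.exp (-x))) := by
    refine tendsto_integral_filter_of_dominated_convergence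
      (fun x => |Real.log x * Real.exp (-x)| + Real.exp (-1 * x) * Real.log (1 + x ^ 2))
      (Eventually.of_forall fun V => Measurable.aestronglyMeasurable (by fun_prop)) ?_
      (hlogint.1.abs.add (integrableOn_exp_mul_log_one_add_sq one_pos)) ?_
    -- For `0 < V < 1`, `log(V² + x²)` lies between `2 log x` and `log(1 + x²)`.
    · filter_upwards [Ioo_mem_nhdsGT (zero_lt_one' ℝ)] with V hV
      filter_upwards [ae_restrict_mem measurableSet_Ioi] with x hx
      have hx : 0 < x := hx
      rw [norm_mul, Real.norm_of_nonneg (Real.exp_pos _).le, abs_mul,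
        abs_of_pos (Real.exp_pos _), neg_one_mul, mul_comm (|Real.log x|), ← mul_add]
      refine mul_le_mul_of_nonneg_left ?_ (Real.exp_pos _).le
      have hVp := hV.1
      have hV2 : V ^ 2 ≤ 1 := by nlinarith [hV.1, hV.2]
      have hup : Real.log (V ^ 2 + x ^ 2) ≤ Real.log (1 + x ^ 2) :=
        Real.log_le_log (by positivity) (by linarith)
      have hlo : 2 * Real.log x ≤ Real.log (V ^ 2 + x ^ 2) := by
        have : Real.log (x ^ 2) = 2 * Real.log x := by rw [Real.log_pow]; norm_num
        rw [← this]
        exact Real.log_le_log (by positivity) (by nlinarith)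
      have := log_one_add_sq_nonneg x
      have h1 := neg_abs_le (Real.log x)
      have h2 := abs_nonneg (Real.log x)
      rw [Real.norm_eq_abs, abs_le]
      constructor <;> linarith
    · filter_upwards [ae_restrict_mem measurableSet_Ioi] with x hx
      have hx : 0 < x := hx
      have hc : ContinuousAt (fun V : ℝ => Real.exp (-x) * (Real.log (V ^ 2 + x ^ 2) / 2)) 0 := by
        have : ((0 : ℝ) ^ 2 + x ^ 2) ≠ 0 := by positivity
        exact continuousAt_const.mul (((continuousAt_id.pow 2).add continuousAt_const).log this
          |>.div_const 2)
      have ht := hc.tendsto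
      have hval : Real.exp (-x) * (Real.log ((0 : ℝ) ^ 2 + x ^ 2) / 2)
          = Real.log x * Real.exp (-x) := by
        rw [zero_pow two_ne_zero, zero_add, Real.log_pow]
        push_cast
        ring
      rw [hval] at ht
      exact ht.mono_left nhdsWithin_le_nhds
  rw [hlogint.2] at h
  refine h.congr' ?_
  filter_upwards [self_mem_nhdsWithin] with V hV
  exact (auxInt_one_add_log hV).symm

lemma tendsto_auxInt_zero : Tendsto (auxInt 0) (𝓝[>] 0) (𝓝 (Real.pi / 2)) := by
  have hpi : ∫ u in Ioi (0 : ℝ), (1 + u ^ 2)⁻¹ = Real.pi / 2 := by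
    rw [integral_Ioi_inv_one_add_sq]; simp
  rw [← hpi]
  refine tendsto_integral_filter_of_dominated_convergence (fun u => (1 + u ^ 2)⁻¹)
    (Eventually.of_forall fun V => Measurable.aestronglyMeasurable (by fun_prop)) ?_
    integrable_inv_one_add_sq.integrableOn ?_
  · filter_upwards [self_mem_nhdsWithin] with V hV
    filter_upwards [ae_restrict_mem measurableSet_Ioi] with u hu
    have hu : 0 < u := hu
    have hV : 0 < V := hV
    rw [Real.norm_of_nonneg (by positivity), pow_zero, one_mul]
    refine mul_le_of_le_one_left (by positivity) (Real.exp_le_one_iff.2 ?_)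
    nlinarith
  · filter_upwards with u
    have hc : Continuous fun V : ℝ => u ^ 0 * Real.exp (-V * u) * (1 + u ^ 2)⁻¹ := by fun_prop
    exact (hc.tendsto' 0 _ (by simp)).mono_left nhdsWithin_le_nhds

lemma eq_of_hasDerivAt_zero_of_tendsto {f : ℝ → ℝ} {c : ℝ} (hf : ∀ x, 0 < x → HasDerivAt f 0 x)
    (hlim : Tendsto f (𝓝[>] 0) (𝓝 c)) {x : ℝ} (hx : 0 < x) : f x = c := by
  have hconst : ∀ y ∈ Ioi (0 : ℝ), f y = f x := fun y hy =>
    isOpen_Ioi.is_const_of_deriv_eq_zero isPreconnected_Ioi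
      (fun z hz => (hf z hz).differentiableAt.differentiableWithinAt)
      (fun z hz => (hf z hz).deriv) hy hx
  refine tendsto_nhds_unique (tendsto_const_nhds.congr' ?_) hlim
  filter_upwards [self_mem_nhdsWithin] with y hy
  exact (hconst y hy).symm

/-- `∫₀^∞ u e^{-Vu} / (1 + u²) du = (π/2 - Si V) sin V - Ci V cos V`. -/
lemma two_mul_auxInt_one {V : ℝ} (hV : 0 < V) : 2 * auxInt 1 V = rateFun V := by
  set A : ℝ → ℝ := fun x =>
    (Real.pi / 2 - sinInt x) * Real.sin x - cosInt x * Real.cos x with hA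
  set B : ℝ → ℝ := fun x =>
    cosInt x * Real.sin x + (Real.pi / 2 - sinInt x) * Real.cos x with hB
  have dA : ∀ x, 0 < x → HasDerivAt A (B x - 1 / x) x := fun x hx => by
    refine ((((hasDerivAt_sinInt hx).const_sub (Real.pi / 2)).mul (Real.hasDerivAt_sin x)).sub
      ((hasDerivAt_cosInt hx).mul (Real.hasDerivAt_cos x))).congr_deriv ?_
    -- The term `1/x` in the derivative of `A` arises as `(sin² + cos²)/x` from differentiating Si
    -- and Ci.
    rw [← Real.sin_sq_add_cos_sq x]
    simp only [hB]
    field_simp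
    ring
  have dB : ∀ x, 0 < x → HasDerivAt B (-A x) x := fun x hx => by
    refine (((hasDerivAt_cosInt hx).mul (Real.hasDerivAt_sin x)).add
      (((hasDerivAt_sinInt hx).const_sub (Real.pi / 2)).mul
        (Real.hasDerivAt_cos x))).congr_deriv ?_
    simp only [hA]
    field_simp
    ring
  -- The errors `D` and `E` of the two candidates satisfy `D' = E`, `E' = -D`: the inhomogeneity
  -- `1/x` cancels.
  have dD : ∀ x, 0 < x → HasDerivAt (fun x => auxInt 1 x - A x) (auxInt 0 x - B x) x :=
    fun x hx => ((hasDerivAt_auxInt 1 hx).sub (dA x hx)).congr_deriv (by rw [auxInt_two hx]; ring)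
  have dE : ∀ x, 0 < x → HasDerivAt (fun x => auxInt 0 x - B x) (-(auxInt 1 x - A x)) x :=
    fun x hx => ((hasDerivAt_auxInt 0 hx).sub (dB x hx)).congr_deriv (by ring)
  have tcos : Tendsto Real.cos (𝓝[>] 0) (𝓝 1) :=
    (Real.continuous_cos.tendsto' 0 1 Real.cos_zero).mono_left nhdsWithin_le_nhds
  have tsin : Tendsto Real.sin (𝓝[>] 0) (𝓝 0) :=
    (Real.continuous_sin.tendsto' 0 0 Real.sin_zero).mono_left nhdsWithin_le_nhds
  -- Both `auxInt 1` and `A` behave like `-γ - log x`; what is left of the logarithm is `log x (1 -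
  -- cos x)`.
  have tD : Tendsto (fun x => auxInt 1 x - A x) (𝓝[>] 0) (𝓝 0) := by
    have h1 := tendsto_log_mul_zero abs_one_sub_cos_le
    have h2 := (((tendsto_sinInt_zero.const_sub (Real.pi / 2)).mul tsin))
    have h3 := ((tendsto_cosSubOneInt_zero.const_add Real.eulerMascheroniConstant).mul tcos)
    have h4 := (tendsto_auxInt_one_add_log.sub ((h2.sub h3).add h1))
    have : -Real.eulerMascheroniConstant
        - ((Real.pi / 2 - 0) * 0 - (Real.eulerMascheroniConstant + 0) * 1 + 0) = 0 := by ring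
    rw [this] at h4
    refine h4.congr fun x => ?_
    simp only [hA, cosInt, cosSubOneInt]
    ring
  have tE : Tendsto (fun x => auxInt 0 x - B x) (𝓝[>] 0) (𝓝 0) := by
    have h1 := tendsto_log_mul_zero (fun x => Real.abs_sin_le_abs (x := x))
    have h2 := (((tendsto_sinInt_zero.const_sub (Real.pi / 2)).mul tcos))
    have h3 := ((tendsto_cosSubOneInt_zero.const_add Real.eulerMascheroniConstant).mul tsin)
    have h4 := (tendsto_auxInt_zero.sub ((h2.add h3).add h1))
    have : Real.pi / 2
        - ((Real.pi / 2 - 0) * 1 + (Real.eulerMascheroniConstant + 0) * 0 + 0) = 0 := by ring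
    rw [this] at h4
    refine h4.congr fun x => ?_
    simp only [hB, cosInt, cosSubOneInt]
    ring
  -- `(D, E)` moves by rotation, so undoing the rotation gives constants, which the limits at `0+`
  -- force to be zero.
  have c1 : (auxInt 1 V - A V) * Real.cos V - (auxInt 0 V - B V) * Real.sin V = 0 := by
    refine eq_of_hasDerivAt_zero_of_tendsto
      (f := fun x => (auxInt 1 x - A x) * Real.cos x - (auxInt 0 x - B x) * Real.sin x)
      (fun x hx => ?_) ?_ hV
    · exact (((dD x hx).mul (Real.hasDerivAt_cos x)).sub
        ((dE x hx).mul (Real.hasDerivAt_sin x))).congr_deriv (by ring)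
    · simpa using (tD.mul tcos).sub (tE.mul tsin)
  have c2 : (auxInt 1 V - A V) * Real.sin V + (auxInt 0 V - B V) * Real.cos V = 0 := by
    refine eq_of_hasDerivAt_zero_of_tendsto
      (f := fun x => (auxInt 1 x - A x) * Real.sin x + (auxInt 0 x - B x) * Real.cos x)
      (fun x hx => ?_) ?_ hV
    · exact (((dD x hx).mul (Real.hasDerivAt_sin x)).add
        ((dE x hx).mul (Real.hasDerivAt_cos x))).congr_deriv (by ring)
    · simpa using (tD.mul tsin).add (tE.mul tcos)
  have hD : auxInt 1 V - A V = 0 := by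
    linear_combination Real.cos V * c1 + Real.sin V * c2
      - (auxInt 1 V - A V) * Real.sin_sq_add_cos_sq V
  have hAV : 2 * A V = rateFun V := by simp only [hA, rateFun]; ring
  linarith

/-- The substitution `t = u²` reduces the integral to `2 * auxInt 1 V`. -/
lemma rateFun_integral_aux {V : ℝ} (hV : 0 < V) :
    IntegrableOn (fun t : ℝ => Real.exp (-(V * √t)) * (1 + t)⁻¹) (Ioi 0) ∧
    ∫ t in Ioi (0 : ℝ), Real.exp (-(V * √t)) * (1 + t)⁻¹ = rateFun V := by
  have hfun : ∀ u ∈ Ioi (0 : ℝ), (|(2 : ℝ)| * u ^ ((2 : ℝ) - 1)) •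
      (Real.exp (-(V * √(u ^ (2 : ℝ)))) * (1 + u ^ (2 : ℝ))⁻¹)
        = 2 * (u ^ 1 * Real.exp (-V * u) * (1 + u ^ 2)⁻¹) := fun u hu => by
    have hu : 0 < u := hu
    have h2 : (2 : ℝ) - 1 = 1 := by norm_num
    rw [h2, Real.rpow_one, Real.rpow_two, Real.sqrt_sq hu.le, abs_two, smul_eq_mul, pow_one,
      neg_mul]
    ring
  constructor
  · rw [← integrableOn_Ioi_comp_rpow_iff _ (two_ne_zero (α := ℝ))]
    exact IntegrableOn.congr_fun ((integrableOn_auxInt 1 hV).const_mul 2) (fun u hu => (hfun u hu).symm)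
      measurableSet_Ioi
  · rw [← integral_comp_rpow_Ioi _ (two_ne_zero (α := ℝ)), setIntegral_congr_fun measurableSet_Ioi hfun,
      integral_const_mul, ← two_mul_auxInt_one hV, auxInt]

/-! ### The extended exponential `e^{-x}` -/

/-- The function `x ↦ e^{-x}` on `[0, ∞]`, with `e^{-∞} = 0`. -/
noncomputable def expNeg (x : ℝ≥0∞) : ℝ≥0∞ := EReal.exp (-(x : EReal))

lemma continuous_expNeg : Continuous expNeg :=
  ENNReal.continuous_exp.comp (continuous_neg.comp continuous_coe_ennreal_ereal)

lemma measurable_expNeg : Measurable expNeg := continuous_expNeg.measurable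

lemma expNeg_ofReal {x : ℝ} (hx : 0 ≤ x) :
    expNeg (ENNReal.ofReal x) = ENNReal.ofReal (Real.exp (-x)) := by
  rw [expNeg, EReal.coe_ennreal_ofReal, max_eq_left hx, ← EReal.coe_neg, EReal.exp_coe]

lemma expNeg_zero : expNeg 0 = 1 := by simp [expNeg]

lemma expNeg_top : expNeg ∞ = 0 := by simp [expNeg]

lemma expNeg_antitone : Antitone expNeg := fun _ _ h =>
  EReal.exp_monotone (EReal.neg_le_neg_iff.2 (EReal.coe_ennreal_le_coe_ennreal_iff.2 h))

lemma expNeg_le_one (x : ℝ≥0∞) : expNeg x ≤ 1 := by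
  rw [← expNeg_zero]
  exact expNeg_antitone zero_le

lemma expNeg_add (x y : ℝ≥0∞) : expNeg (x + y) = expNeg x * expNeg y := by
  induction x with
  | top => simp [expNeg_top]
  | coe x =>
    induction y with
    | top => simp [expNeg_top]
    | coe y =>
      rw [← ENNReal.ofReal_coe_nnreal, ← ENNReal.ofReal_coe_nnreal,
        ← ENNReal.ofReal_add x.coe_nonneg y.coe_nonneg, expNeg_ofReal (by positivity),
        expNeg_ofReal x.coe_nonneg, expNeg_ofReal y.coe_nonneg,
        ← ENNReal.ofReal_mul (Real.exp_pos _).le, ← Real.exp_add, neg_add]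

lemma expNeg_sum {ι : Type*} (s : Finset ι) (f : ι → ℝ≥0∞) :
    expNeg (∑ i ∈ s, f i) = ∏ i ∈ s, expNeg (f i) := by
  classical
  induction s using Finset.induction_on with
  | empty => simp [expNeg_zero]
  | insert a s ha ih => rw [Finset.sum_insert ha, Finset.prod_insert ha, expNeg_add, ih]

/-- The inverse of `expNeg` on `[0, 1]`. -/
noncomputable def negLog (y : ℝ≥0∞) : ℝ≥0∞ := (-ENNReal.log y).toENNReal

lemma measurable_negLog : Measurable negLog := by
  unfold negLog
  fun_prop

lemma expNeg_negLog {y : ℝ≥0∞} (hy : y ≤ 1) : expNeg (negLog y) = y := by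
  have h : ENNReal.log y ≤ 0 := by
    rw [← ENNReal.log_one]
    exact ENNReal.log_monotone hy
  rw [expNeg, negLog, EReal.coe_toENNReal (by simpa using h), neg_neg, ENNReal.exp_log]

/-! ### The Laplace functional of a Poisson process -/

/-- Sum the exponential series: this is the Poisson generating function evaluated at `e^{-c}`. -/
lemma lintegral_expNeg_poisson (r : ℝ≥0) {c : ℝ≥0∞} (hc : c ≠ ∞) :
    ∫⁻ n : ℕ, expNeg (c * n) ∂(poissonMeasure r) = expNeg (r * (1 - expNeg c)) := by
  lift c to ℝ≥0 using hc with a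
  have ha : (0 : ℝ) ≤ a := a.coe_nonneg
  have hr : (0 : ℝ) ≤ r := r.coe_nonneg
  rw [poissonMeasure, lintegral_sum_measure]
  have h1 : ∀ n : ℕ, ∫⁻ m : ℕ, expNeg ((a : ℝ≥0∞) * m)
      ∂(ENNReal.ofReal (Real.exp (-r) * r ^ n / n.factorial) • Measure.dirac n)
      = ENNReal.ofReal (Real.exp (-r) * ((r * Real.exp (-a)) ^ n / n.factorial)) := fun n => by
    rw [lintegral_smul_measure, lintegral_dirac, smul_eq_mul, ← ENNReal.ofReal_coe_nnreal,
      ← ENNReal.ofReal_natCast, ← ENNReal.ofReal_mul ha, expNeg_ofReal (by positivity),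
      ← ENNReal.ofReal_mul (by positivity), mul_pow, ← Real.exp_nat_mul]
    congr 1
    have : -((a : ℝ) * n) = n * -a := by ring
    rw [this]
    ring
  simp_rw [h1]
  have hs : HasSum (fun n : ℕ => (r * Real.exp (-a)) ^ n / (n.factorial : ℝ))
      (Real.exp (r * Real.exp (-a))) := by
    rw [Real.exp_eq_exp_ℝ]
    exact NormedSpace.expSeries_div_hasSum_exp _
  rw [← ENNReal.ofReal_tsum_of_nonneg (fun n => by positivity) (hs.mul_left _).summable,
    (hs.mul_left _).tsum_eq, ← Real.exp_add, ← ENNReal.ofReal_coe_nnreal (p := a), expNeg_ofReal ha,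
    ← ENNReal.ofReal_one, ← ENNReal.ofReal_sub _ (Real.exp_pos _).le, ← ENNReal.ofReal_coe_nnreal,
    ← ENNReal.ofReal_mul hr, expNeg_ofReal]
  · congr 2; ring
  · have : Real.exp (-(a : ℝ)) ≤ 1 := Real.exp_le_one_iff.2 (by linarith)
    exact mul_nonneg hr (by linarith)

/-- The value `0` is left out: it contributes nothing, and its level set may have infinite area,
where `IsHPPP` says nothing about the counts. -/
lemma simpleFunc_eq_sum {E : Type*} [MeasurableSpace E] (t : SimpleFunc E ℝ≥0∞) (x : E) :
    t x = ∑ c ∈ t.range.filter (· ≠ 0), c * (t ⁻¹' {c}).indicator (fun _ => (1 : ℝ≥0∞)) x := by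
  classical
  have h : ∀ c ∈ t.range.filter (· ≠ 0), c ≠ t x →
      c * (t ⁻¹' {c}).indicator (fun _ => (1 : ℝ≥0∞)) x = 0 := fun c _ hc => by
    rw [indicator_of_notMem, mul_zero]
    simpa using hc.symm
  by_cases h0 : t x = 0
  · rw [Finset.sum_eq_zero, h0]
    intro c hc
    exact h c hc fun hh => (Finset.mem_filter.1 hc).2 (hh.trans h0)
  · rw [Finset.sum_eq_single_of_mem (t x) (by simp [h0]) h]
    simp

lemma tsum_simpleFunc_eq {Ω : Type*} {X : ℕ → Ω → Plane} (t : SimpleFunc Plane ℝ≥0∞) (ω : Ω) :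
    ∑' k, t (X k ω) = ∑ c ∈ t.range.filter (· ≠ 0), c * pointCount X (t ⁻¹' {c}) ω := by
  simp_rw [simpleFunc_eq_sum t]
  rw [Summable.tsum_finsetSum fun _ _ => ENNReal.summable]
  simp_rw [ENNReal.tsum_mul_left]
  rfl

variable {Ω : Type*} [MeasurableSpace Ω]

lemma measurable_pointCount {X : ℕ → Ω → Plane} (hX : ∀ k, Measurable (X k)) {A : Set Plane}
    (hA : MeasurableSet A) : Measurable (pointCount X A) :=
  Measurable.tsum fun k => (measurable_const.indicator hA).comp (hX k)

/-- The sum over points is a finite combination of counts in the disjoint nonzero level sets. These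
counts are independent and Poisson, so the expectation factors into Poisson generating functions. -/
lemma IsHPPP.lintegral_expNeg_simpleFunc {lam : ℝ} {X : ℕ → Ω → Plane} {P : Measure Ω}
    (h : IsHPPP lam X P) (t : SimpleFunc Plane ℝ≥0∞) (ht : ∀ x, t x ≠ ∞)
    (hfin : ∀ c, c ≠ 0 → volume (t ⁻¹' {c}) ≠ ∞) :
    ∫⁻ ω, expNeg (∑' k, t (X k ω)) ∂P =
      expNeg (ENNReal.ofReal lam * ∫⁻ x, (1 - expNeg (t x))) := by
  classical
  set s := t.range.filter (· ≠ 0) with hs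
  have hs0 : ∀ c : s, (c : ℝ≥0∞) ≠ 0 := fun c => (Finset.mem_filter.1 c.2).2
  have hs_ne_top : ∀ c : s, (c : ℝ≥0∞) ≠ ∞ := fun c => by
    obtain ⟨x, hx⟩ := SimpleFunc.mem_range.1 (Finset.mem_filter.1 c.2).1
    rw [← hx]; exact ht x
  have hmeas : ∀ c : ℝ≥0∞, MeasurableSet (t ⁻¹' {c}) := fun c => t.measurableSet_fiber c
  have hind : iIndepFun (fun c : s => pointCount X (t ⁻¹' {(c : ℝ≥0∞)})) P := by
    have h1 := h.indep _ (fun i => t ⁻¹' {((Fintype.equivFin s).symm i : ℝ≥0∞)})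
      (fun i => hmeas _) (fun i => hfin _ (hs0 _)) (fun i j hij => by
        refine Disjoint.preimage _ (Set.disjoint_singleton.2 fun hh => hij ?_)
        exact (Fintype.equivFin s).symm.injective (Subtype.ext hh))
    have h2 := h1.precomp (Fintype.equivFin s).injective
    simpa [Function.comp_def] using h2
  have hind2 : iIndepFun (fun (c : s) ω => expNeg (c * pointCount X (t ⁻¹' {(c : ℝ≥0∞)}) ω)) P :=
    hind.comp (fun c y => expNeg (c * y)) fun c =>
      measurable_expNeg.comp (measurable_id.const_mul _)
  have hsplit : ∀ ω, expNeg (∑' k, t (X k ω)) =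
      ∏ c : s, expNeg (c * pointCount X (t ⁻¹' {(c : ℝ≥0∞)}) ω) := fun ω => by
    rw [tsum_simpleFunc_eq, expNeg_sum]
    exact (Finset.prod_coe_sort s fun c => expNeg (c * pointCount X (t ⁻¹' {c}) ω)).symm
  simp_rw [hsplit]
  rw [lintegral_prod_eq_prod_lintegral_of_indepFun _ _ hind2 fun c =>
    measurable_expNeg.comp ((measurable_pointCount h.measurable (hmeas _)).const_mul _)]
  have hone : ∀ c : s, ∫⁻ ω, expNeg (c * pointCount X (t ⁻¹' {(c : ℝ≥0∞)}) ω) ∂P =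
      expNeg (ENNReal.ofReal lam * ((1 - expNeg c) * volume (t ⁻¹' {(c : ℝ≥0∞)}))) := fun c => by
    have hl := (h.hasLaw _ (hmeas c) (hfin _ (hs0 c))).lintegral_comp
      (f := fun y => expNeg (c * y)) (measurable_expNeg.comp (measurable_id.const_mul _)).aemeasurable
    rw [hl, lintegral_map (f := fun y => expNeg (c * y))
      (measurable_expNeg.comp (measurable_id.const_mul _)) (by fun_prop),
      lintegral_expNeg_poisson _ (hs_ne_top c), ENNReal.coe_toNNReal]
    · congr 1; ring
    · exact ENNReal.mul_ne_top ENNReal.ofReal_ne_top (hfin _ (hs0 c))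
  simp_rw [hone]
  rw [← expNeg_sum, ← Finset.mul_sum]
  congr 2
  have h1 : ∫⁻ x, (1 - expNeg (t x)) = (t.map fun y => 1 - expNeg y).lintegral volume := by
    rw [← SimpleFunc.lintegral_eq_lintegral]
    rfl
  rw [h1, SimpleFunc.map_lintegral,
    Finset.sum_coe_sort s fun c => (1 - expNeg c) * volume (t ⁻¹' {c}), hs]
  refine Finset.sum_filter_of_ne fun c _ hc hc0 => hc ?_
  simp [hc0, expNeg_zero]

lemma tendsto_tsum_of_monotone {f : ℕ → ℕ → ℝ≥0∞} {g : ℕ → ℝ≥0∞}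
    (hmono : ∀ k, Monotone fun n => f n k) (hlim : ∀ k, Tendsto (fun n => f n k) atTop (𝓝 (g k))) :
    Tendsto (fun n => ∑' k, f n k) atTop (𝓝 (∑' k, g k)) := by
  simp_rw [← lintegral_count]
  exact lintegral_tendsto_of_tendsto_of_monotone
    (fun n => (measurable_of_countable _).aemeasurable) (Eventually.of_forall hmono)
    (Eventually.of_forall hlim)

/-- Approximate `ψ` from below by simple functions and pass to the limit: dominated convergence (by
`1`) on the left, monotone convergence on the right. -/
lemma IsHPPP.lintegral_expNeg_tsum {lam : ℝ} {X : ℕ → Ω → Plane} {P : Measure Ω}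
    [IsProbabilityMeasure P] (h : IsHPPP lam X P) {ψ : Plane → ℝ≥0∞} (hψ : Measurable ψ) :
    ∫⁻ ω, expNeg (∑' k, ψ (X k ω)) ∂P =
      expNeg (ENNReal.ofReal lam * ∫⁻ x, (1 - expNeg (ψ x))) := by
  classical
  have hball : ∀ n : ℕ, MeasurableSet (Metric.ball (0 : Plane) n) :=
    fun n => measurableSet_ball
  -- Cutting off outside the ball of radius `n` gives every nonzero level set finite area.
  set t : ℕ → SimpleFunc Plane ℝ≥0∞ := fun n =>
    (SimpleFunc.eapprox ψ n).restrict (Metric.ball 0 n) with ht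
  have htx : ∀ n x, t n x = (Metric.ball (0 : Plane) n).indicator (SimpleFunc.eapprox ψ n) x :=
    fun n x => by rw [ht]; exact SimpleFunc.restrict_apply _ (hball n) x
  have hmono : ∀ x, Monotone fun n => t n x := fun x m n hmn => by
    simp only [htx]
    by_cases hx : x ∈ Metric.ball (0 : Plane) m
    · have hx' : x ∈ Metric.ball (0 : Plane) n := Metric.ball_subset_ball (by exact_mod_cast hmn) hx
      rw [indicator_of_mem hx, indicator_of_mem hx']
      exact SimpleFunc.monotone_eapprox ψ hmn x
    · rw [indicator_of_notMem hx]; exact zero_le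
  have hlim : ∀ x, Tendsto (fun n => t n x) atTop (𝓝 (ψ x)) := fun x => by
    have h1 : Tendsto (fun n => SimpleFunc.eapprox ψ n x) atTop (𝓝 (ψ x)) := by
      rw [← SimpleFunc.iSup_eapprox_apply hψ x]
      exact tendsto_atTop_iSup fun m n hmn => SimpleFunc.monotone_eapprox ψ hmn x
    refine h1.congr' ?_
    obtain ⟨N, hN⟩ := exists_nat_gt ‖x‖
    filter_upwards [eventually_ge_atTop N] with n hn
    rw [htx, indicator_of_mem]
    rw [mem_ball_zero_iff]
    exact hN.trans_le (by exact_mod_cast hn)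
  have hstep : ∀ n, ∫⁻ ω, expNeg (∑' k, t n (X k ω)) ∂P =
      expNeg (ENNReal.ofReal lam * ∫⁻ x, (1 - expNeg (t n x))) := fun n => by
    refine h.lintegral_expNeg_simpleFunc (t n) (fun x => ?_) (fun c hc => ?_)
    · rw [htx]
      by_cases hx : x ∈ Metric.ball (0 : Plane) n
      · rw [indicator_of_mem hx]; exact (SimpleFunc.eapprox_lt_top ψ n x).ne
      · rw [indicator_of_notMem hx]; exact ENNReal.zero_ne_top
    · refine measure_ne_top_of_subset (s := Metric.ball 0 n) (fun x hx => ?_)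
        (measure_ball_lt_top (μ := (volume : Measure Plane))).ne
      by_contra hx'
      have : t n x = c := hx
      rw [htx, indicator_of_notMem hx'] at this
      exact hc this.symm
  have hL : Tendsto (fun n => ∫⁻ ω, expNeg (∑' k, t n (X k ω)) ∂P) atTop
      (𝓝 (∫⁻ ω, expNeg (∑' k, ψ (X k ω)) ∂P)) := by
    refine tendsto_lintegral_of_dominated_convergence (fun _ => 1) (fun n => ?_) (fun n => ?_)
      (by simp) ?_
    · exact measurable_expNeg.comp (Measurable.tsum fun k =>
        (t n).measurable.comp (h.measurable k))
    · exact Eventually.of_forall fun ω => expNeg_le_one _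
    · refine Eventually.of_forall fun ω => (continuous_expNeg.tendsto _).comp ?_
      exact tendsto_tsum_of_monotone (fun k => hmono _) fun k => hlim _
  have hR : Tendsto (fun n => ∫⁻ x, (1 - expNeg (t n x))) atTop
      (𝓝 (∫⁻ x, (1 - expNeg (ψ x)))) := by
    refine lintegral_tendsto_of_tendsto_of_monotone (fun n => ?_) ?_ ?_
    · exact (measurable_const.sub (measurable_expNeg.comp (t n).measurable)).aemeasurable
    · exact Eventually.of_forall fun x m n hmn => tsub_le_tsub_left (expNeg_antitone (hmono x hmn)) 1
    · exact Eventually.of_forall fun x => ENNReal.Tendsto.sub tendsto_const_nhds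
        ((continuous_expNeg.tendsto _).comp (hlim x)) (Or.inl ENNReal.one_ne_top)
  refine tendsto_nhds_unique hL ?_
  simp_rw [hstep]
  exact (continuous_expNeg.tendsto _).comp
    (ENNReal.Tendsto.const_mul hR (Or.inr ENNReal.ofReal_ne_top))

/-- The Laplace functional of an independently marked homogeneous Poisson process. -/
lemma IsHPPP.lintegral_expNeg_tsum_marked {E : Type*} [MeasurableSpace E] {lam : ℝ}
    {X : ℕ → Ω → Plane} {M : ℕ → Ω → E} {P : Measure Ω} [IsProbabilityMeasure P]
    {Q : Measure E} [IsProbabilityMeasure Q] (h : IsHPPP lam X P) (hM : ∀ k, Measurable (M k))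
    (hlaw : ∀ k, HasLaw (M k) Q P) (hiid : iIndepFun M P)
    (hind : IndepFun (fun ω k => X k ω) (fun ω k => M k ω) P)
    {f : Plane × E → ℝ≥0∞} (hf : Measurable f) :
    ∫⁻ ω, expNeg (∑' k, f (X k ω, M k ω)) ∂P =
      expNeg (ENNReal.ofReal lam * ∫⁻ x, (1 - ∫⁻ m, expNeg (f (x, m)) ∂Q)) := by
  set φ : Plane → ℝ≥0∞ := fun x => ∫⁻ m, expNeg (f (x, m)) ∂Q with hφ
  have hφm : Measurable φ := (measurable_expNeg.comp hf).lintegral_prod_right'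
  have hφ1 : ∀ x, φ x ≤ 1 := fun x =>
    (lintegral_mono fun m => expNeg_le_one _).trans (by simp)
  have hXm : Measurable fun ω k => X k ω := measurable_pi_lambda _ h.measurable
  have hMm : Measurable fun ω k => M k ω := measurable_pi_lambda _ hM
  -- With the positions frozen, independent marks integrate out factor by factor, leaving `∏ φ (X
  -- k)`. Writing `φ` as `expNeg (negLog φ)` makes this an unmarked functional. Partial sums are
  -- used because independence only factors finite products.
  have hstep : ∀ n, ∫⁻ ω, expNeg (∑ k ∈ Finset.range n, f (X k ω, M k ω)) ∂P =
      ∫⁻ ω, expNeg (∑ k ∈ Finset.range n, negLog (φ (X k ω))) ∂P := fun n => by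
    have hG : Measurable fun z : (ℕ → Plane) × (ℕ → E) =>
        ∏ k ∈ Finset.range n, expNeg (f (z.1 k, z.2 k)) := by
      refine Finset.measurable_prod _ fun k _ => measurable_expNeg.comp (hf.comp ?_)
      fun_prop
    have h1 : ∫⁻ ω, expNeg (∑ k ∈ Finset.range n, f (X k ω, M k ω)) ∂P =
        ∫⁻ z, ∏ k ∈ Finset.range n, expNeg (f (z.1 k, z.2 k))
          ∂(P.map fun ω => ((fun k => X k ω), (fun k => M k ω))) := by
      rw [lintegral_map hG (hXm.prodMk hMm)]
      simp_rw [expNeg_sum]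
    have : IsProbabilityMeasure (P.map fun ω k => M k ω) :=
      Measure.isProbabilityMeasure_map hMm.aemeasurable
    rw [h1, (indepFun_iff_map_prod_eq_prod_map_map hXm.aemeasurable hMm.aemeasurable).1 hind,
      lintegral_prod _ hG.aemeasurable, lintegral_map hG.lintegral_prod_right' hXm]
    refine lintegral_congr fun ω => ?_
    rw [lintegral_map (f := fun y => ∏ k ∈ Finset.range n, expNeg (f (X k ω, y k)))
      (hG.comp (measurable_prodMk_left (x := fun k => X k ω))) hMm]
    have hi : iIndepFun (fun k ω' => expNeg (f (X k ω, M k ω'))) P :=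
      hiid.comp (fun k m => expNeg (f (X k ω, m))) fun k =>
        measurable_expNeg.comp (hf.comp measurable_prodMk_left)
    have h2 := lintegral_prod_eq_prod_lintegral_of_indepFun (Finset.range n) _ hi fun k =>
      measurable_expNeg.comp (hf.comp (measurable_const.prodMk (hM k)))
    simp only
    rw [h2, expNeg_sum]
    refine Finset.prod_congr rfl fun k _ => ?_
    rw [expNeg_negLog (hφ1 _), hφ]
    exact (hlaw k).lintegral_comp (f := fun m => expNeg (f (X k ω, m)))
      (measurable_expNeg.comp (hf.comp measurable_prodMk_left)).aemeasurable
  have hlim : ∀ F : ℕ → Ω → ℝ≥0∞, (∀ k, Measurable (F k)) →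
      Tendsto (fun n => ∫⁻ ω, expNeg (∑ k ∈ Finset.range n, F k ω) ∂P) atTop
        (𝓝 (∫⁻ ω, expNeg (∑' k, F k ω) ∂P)) := fun F hF => by
    refine tendsto_lintegral_of_dominated_convergence (fun _ => 1) (fun n => ?_) (fun n => ?_)
      (by simp) ?_
    · exact measurable_expNeg.comp (Finset.measurable_sum _ fun k _ => hF k)
    · exact Eventually.of_forall fun ω => expNeg_le_one _
    · exact Eventually.of_forall fun ω => (continuous_expNeg.tendsto _).comp
        (ENNReal.tendsto_nat_tsum _)
  have hA := hlim (fun k ω => f (X k ω, M k ω)) fun k => hf.comp ((h.measurable k).prodMk (hM k))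
  have hB := hlim (fun k ω => negLog (φ (X k ω))) fun k =>
    measurable_negLog.comp (hφm.comp (h.measurable k))
  simp_rw [hstep] at hA
  rw [tendsto_nhds_unique hA hB,
    h.lintegral_expNeg_tsum (ψ := fun x => negLog (φ x)) (measurable_negLog.comp hφm)]
  simp_rw [expNeg_negLog (hφ1 _), hφ]

/-! ### Gaussian fading -/

lemma lintegral_exp_neg_sq_gaussianReal (v : ℝ≥0) {s : ℝ} (hs : 0 ≤ s) :
    ∫⁻ x, ENNReal.ofReal (Real.exp (-(s * x ^ 2))) ∂(gaussianReal 0 v) =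
      ENNReal.ofReal (√(1 / (1 + 2 * s * v))) := by
  by_cases hv : v = 0
  · simp [hv, gaussianReal_zero_var]
  have hv' : (0 : ℝ) < v := by positivity
  have hint : Integrable (fun x : ℝ => Real.exp (-(s * x ^ 2))) (gaussianReal 0 v) := by
    refine Integrable.of_bound (Measurable.aestronglyMeasurable (by fun_prop)) 1
      (Eventually.of_forall fun x => ?_)
    rw [Real.norm_of_nonneg (Real.exp_pos _).le, Real.exp_le_one_iff]
    have := mul_nonneg hs (sq_nonneg x)
    linarith
  rw [← ofReal_integral_eq_lintegral_ofReal hint (Eventually.of_forall fun x => (Real.exp_pos _).le),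
    integral_gaussianReal_eq_integral_smul hv]
  congr 1
  have h1 : ∀ x : ℝ, gaussianPDFReal 0 v x • Real.exp (-(s * x ^ 2)) =
      (√(2 * Real.pi * v))⁻¹ * Real.exp (-(s + 1 / (2 * v)) * x ^ 2) := fun x => by
    rw [gaussianPDFReal, smul_eq_mul, mul_assoc, ← Real.exp_add]
    congr 2
    field_simp
    ring
  simp_rw [h1]
  rw [integral_const_mul, integral_gaussian, ← Real.sqrt_inv, ← Real.sqrt_mul (by positivity)]
  congr 1
  have := Real.pi_pos
  field_simp
  ring

lemma gaussianReal_prod_map_linear (v w : ℝ≥0) (c d : ℝ) :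
    ((gaussianReal 0 v).prod (gaussianReal 0 w)).map (fun z => c * z.1 + d * z.2) =
      gaussianReal 0 (.mk (c ^ 2) (sq_nonneg c) * v + .mk (d ^ 2) (sq_nonneg d) * w) := by
  have h := gaussianReal_conv_gaussianReal (m₁ := c * 0) (m₂ := d * 0)
    (v₁ := .mk (c ^ 2) (sq_nonneg c) * v) (v₂ := .mk (d ^ 2) (sq_nonneg d) * w)
  rw [← gaussianReal_map_const_mul, ← gaussianReal_map_const_mul, Measure.conv,
    Measure.map_prod_map _ _ (by fun_prop) (by fun_prop), Measure.map_map (by fun_prop)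
    (by fun_prop)] at h
  simpa [Function.comp_def] using h

lemma measurable_complex_mk : Measurable fun z : ℝ × ℝ => (⟨z.1, z.2⟩ : ℂ) :=
  Complex.measurableEquivRealProd.symm.measurable

instance isProbabilityMeasure_complexNormal (v : ℝ≥0) : IsProbabilityMeasure (complexNormal v) :=
  Measure.isProbabilityMeasure_map measurable_complex_mk.aemeasurable

lemma norm_sq_linear_combination (a b : ℝ) (z w : ℝ × ℝ) :
    ‖(a : ℂ) * (⟨z.1, z.2⟩ : ℂ) + (b : ℂ) * (⟨w.1, w.2⟩ : ℂ)‖ ^ 2 =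
      (a * z.1 + b * w.1) ^ 2 + (a * z.2 + b * w.2) ^ 2 := by
  rw [Complex.sq_norm, Complex.normSq_apply]
  simp
  ring

/-- The Laplace transform of the squared modulus of a linear combination of two independent
circularly symmetric complex Gaussian variables. -/
lemma lintegral_exp_neg_norm_sq_complexNormal (v w : ℝ≥0) (a b : ℝ) {s : ℝ} (hs : 0 ≤ s) :
    ∫⁻ z, ENNReal.ofReal (Real.exp (-(s * ‖(a : ℂ) * z.1 + (b : ℂ) * z.2‖ ^ 2)))
        ∂((complexNormal v).prod (complexNormal w)) =
      ENNReal.ofReal (1 / (1 + s * (a ^ 2 * v + b ^ 2 * w))) := by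
  -- The real and imaginary parts of the combination are independent with the same centred Gaussian
  -- law. Each contributes a factor `(1 + s(a²v + b²w))^{-1/2}`, and the two factors multiply to the
  -- claim.
  set F : ℝ → ℝ → ℝ≥0∞ := fun x y => ENNReal.ofReal (Real.exp (-(s * (a * x + b * y) ^ 2))) with hF
  have hFm : Measurable (Function.uncurry F) := by
    simp only [hF, Function.uncurry_def]
    fun_prop
  set G : ℝ → ℝ≥0∞ := fun x => ∫⁻ y, F x y ∂(gaussianReal 0 (w / 2)) with hG
  have hGm : Measurable G := hFm.lintegral_prod_right'
  have hGint : ∫⁻ x, G x ∂(gaussianReal 0 (v / 2)) =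
      ENNReal.ofReal (√(1 / (1 + s * (a ^ 2 * v + b ^ 2 * w)))) := by
    have h1 := lintegral_prod (μ := gaussianReal 0 (v / 2)) (ν := gaussianReal 0 (w / 2))
      _ hFm.aemeasurable
    have h2 := lintegral_exp_neg_sq_gaussianReal
      (.mk (a ^ 2) (sq_nonneg a) * (v / 2) + .mk (b ^ 2) (sq_nonneg b) * (w / 2)) hs
    rw [← gaussianReal_prod_map_linear, lintegral_map (by fun_prop) (by fun_prop)] at h2
    refine (h1.symm.trans h2).trans ?_
    congr 4
    push_cast
    ring
  rw [complexNormal, complexNormal, Measure.map_prod_map _ _ measurable_complex_mk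
    measurable_complex_mk, lintegral_map (by fun_prop)
    (measurable_complex_mk.prodMap measurable_complex_mk), lintegral_prod _ ?_]
  · have h3 : ∀ x y : ℝ × ℝ, ENNReal.ofReal (Real.exp (-(s * ‖(a : ℂ) *
        (Prod.map (fun z : ℝ × ℝ => (⟨z.1, z.2⟩ : ℂ)) (fun z : ℝ × ℝ => (⟨z.1, z.2⟩ : ℂ)) (x, y)).1
        + (b : ℂ) * (Prod.map (fun z : ℝ × ℝ => (⟨z.1, z.2⟩ : ℂ))
          (fun z : ℝ × ℝ => (⟨z.1, z.2⟩ : ℂ)) (x, y)).2‖ ^ 2)))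
        = F x.1 y.1 * F x.2 y.2 := fun x y => by
      simp only [Prod.map, hF]
      rw [norm_sq_linear_combination, ← ENNReal.ofReal_mul (Real.exp_pos _).le, ← Real.exp_add]
      congr 2
      ring
    simp_rw [h3]
    have h4 : ∀ x : ℝ × ℝ, ∫⁻ y : ℝ × ℝ, F x.1 y.1 * F x.2 y.2
        ∂((gaussianReal 0 (w / 2)).prod (gaussianReal 0 (w / 2))) = G x.1 * G x.2 := fun x =>
      lintegral_prod_mul (hFm.comp measurable_prodMk_left).aemeasurable
        (hFm.comp measurable_prodMk_left).aemeasurable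
    simp_rw [h4]
    rw [lintegral_prod_mul hGm.aemeasurable hGm.aemeasurable, hGint,
      ← ENNReal.ofReal_mul (Real.sqrt_nonneg _), Real.mul_self_sqrt]
    have := v.coe_nonneg
    have := w.coe_nonneg
    positivity
  · refine Measurable.aemeasurable (Measurable.comp (g := fun z : ℂ × ℂ =>
      ENNReal.ofReal (Real.exp (-(s * ‖(a : ℂ) * z.1 + (b : ℂ) * z.2‖ ^ 2)))) (by fun_prop)
      (measurable_complex_mk.prodMap measurable_complex_mk))

lemma isProbabilityMeasure_coinLaw {p : ℝ} (hp0 : 0 ≤ p) (hp1 : p ≤ 1) :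
    IsProbabilityMeasure (coinLaw p) := by
  constructor
  simp only [coinLaw, Measure.add_apply, Measure.smul_apply, measure_univ, smul_eq_mul, mul_one]
  rw [← ENNReal.ofReal_add hp0 (by linarith)]
  simp

lemma lintegral_coinLaw (p : ℝ) (f : Bool → ℝ≥0∞) :
    ∫⁻ b, f b ∂(coinLaw p) = ENNReal.ofReal p * f true + ENNReal.ofReal (1 - p) * f false := by
  rw [coinLaw, lintegral_add_measure, lintegral_smul_measure, lintegral_smul_measure,
    lintegral_dirac, lintegral_dirac, smul_eq_mul, smul_eq_mul]

/-! ### The interference power of a single transmitter -/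

lemma measurable_interfererPower (θ : Params) :
    Measurable fun z : Plane × Mark => interfererPower θ z.1 z.2 := by
  unfold interfererPower Params.directLoss Params.reflectedLoss
  refine Measurable.ite ?_ ?_ ?_
  · exact (measurable_fst.comp measurable_snd) (measurableSet_singleton true)
  · fun_prop
  · fun_prop

lemma interfererPower_nonneg (θ : Params) (x : Plane) (m : Mark) : 0 ≤ interfererPower θ x m := by
  unfold interfererPower
  split_ifs <;> positivity

lemma Params.e1_pos (θ : Params) : 0 < θ.e1 := by
  have h1 := θ.Cd_pos
  have h2 := θ.Cr_pos
  have h3 := Real.rpow_pos_of_pos θ.d0_pos (-θ.α)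
  unfold Params.e1
  positivity

/-- The law of a mark. -/
noncomputable def markLaw (θ : Params) : Measure Mark :=
  (coinLaw θ.p).prod ((complexNormal 1).prod (complexNormal θ.N))

lemma isProbabilityMeasure_markLaw (θ : Params) : IsProbabilityMeasure (markLaw θ) := by
  have := isProbabilityMeasure_coinLaw θ.p_nonneg θ.p_le_one
  unfold markLaw
  infer_instance

/-- Given the RIS indicator, the power is exponential. Its mean with an RIS is direct loss plus `N`
times reflected loss, and `e1` is exactly what remains after factoring out `‖x‖ ^ (-α)`. -/
lemma lintegral_markLaw (θ : Params) (x : Plane) {s : ℝ} (hs : 0 ≤ s) :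
    ∫⁻ m, expNeg (ENNReal.ofReal (s * interfererPower θ x m)) ∂(markLaw θ) =
      ENNReal.ofReal (θ.p * (1 / (1 + s * (θ.e1 * ‖x‖ ^ (-θ.α)))) +
        (1 - θ.p) * (1 / (1 + s * (θ.Cd * ‖x‖ ^ (-θ.α))))) := by
  have hp0 := θ.p_nonneg
  have hp1 : 0 ≤ 1 - θ.p := by linarith [θ.p_le_one]
  have hCd := θ.Cd_pos
  have hCr := θ.Cr_pos
  have hd0 := θ.d0_pos
  have hx := Real.rpow_nonneg (norm_nonneg x) (-θ.α)
  have he := θ.e1_pos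
  have h0 : ∀ m, expNeg (ENNReal.ofReal (s * interfererPower θ x m)) =
      ENNReal.ofReal (Real.exp (-(s * interfererPower θ x m))) := fun m =>
    expNeg_ofReal (mul_nonneg hs (interfererPower_nonneg θ x m))
  simp_rw [h0]
  have hm : Measurable fun m => ENNReal.ofReal (Real.exp (-(s * interfererPower θ x m))) := by
    have := (measurable_interfererPower θ).comp (measurable_prodMk_left (x := x))
    exact (Real.measurable_exp.comp (this.const_mul s).neg).ennreal_ofReal
  have hdl : 0 ≤ θ.directLoss ‖x‖ := by unfold Params.directLoss; positivity
  have hrl : 0 ≤ θ.reflectedLoss ‖x‖ := by unfold Params.reflectedLoss; positivity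
  have h1 := lintegral_exp_neg_norm_sq_complexNormal 1 θ.N (√(θ.directLoss ‖x‖))
    (√(θ.reflectedLoss ‖x‖)) hs
  -- Without an RIS the same formula applies with second coefficient `0`.
  have h2 := lintegral_exp_neg_norm_sq_complexNormal 1 θ.N (√(θ.directLoss ‖x‖)) 0 hs
  rw [Real.sq_sqrt hdl, Real.sq_sqrt hrl] at h1
  rw [Real.sq_sqrt hdl] at h2
  simp only [Complex.ofReal_zero, zero_mul, add_zero, ne_eq, OfNat.ofNat_ne_zero,
    not_false_eq_true, zero_pow] at h2
  have e1 : θ.directLoss ‖x‖ * ((1 : ℝ≥0) : ℝ) + θ.reflectedLoss ‖x‖ * ((θ.N : ℝ≥0) : ℝ)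
      = θ.e1 * ‖x‖ ^ (-θ.α) := by
    rw [Params.directLoss, Params.reflectedLoss, Params.e1, Real.mul_rpow hd0.le (norm_nonneg x)]
    push_cast
    ring
  rw [e1] at h1
  rw [markLaw, lintegral_prod _ hm.aemeasurable, lintegral_coinLaw]
  simp only [interfererPower, if_true, Bool.false_eq_true, if_false]
  rw [h1, h2, ← ENNReal.ofReal_mul hp0, ← ENNReal.ofReal_mul hp1, ← ENNReal.ofReal_add]
  · simp [Params.directLoss]
  · positivity
  · simp only [NNReal.coe_one, mul_one]; positivity

/-! ### Integration over the plane -/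

/-- For path loss exponent 4 the integrand has the elementary primitive `(√A / 2) arctan(r² / √A)`.
-/
lemma integrableOn_and_integral_radial {A : ℝ} (hA : 0 < A) :
    IntegrableOn (fun r : ℝ => r * (A / (r ^ 4 + A))) (Ioi 0) ∧
      ∫ r in Ioi (0 : ℝ), r * (A / (r ^ 4 + A)) = Real.pi / 4 * √A := by
  set B := √A with hB
  have hBpos : 0 < B := Real.sqrt_pos.2 hA
  have hAB : A = B ^ 2 := (Real.sq_sqrt hA.le).symm
  have hd : ∀ r : ℝ, HasDerivAt (fun r : ℝ => B / 2 * Real.arctan (r ^ 2 / B))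
      (r * (A / (r ^ 4 + A))) r := fun r => by
    have h1 : HasDerivAt (fun r : ℝ => r ^ 2 / B) (2 * r / B) r := by
      simpa using (hasDerivAt_pow 2 r).div_const B
    refine (h1.arctan.const_mul (B / 2)).congr_deriv ?_
    have h2 : r ^ 4 + B ^ 2 ≠ 0 := by positivity
    have h3 : 1 + (r ^ 2 / B) ^ 2 ≠ 0 := by positivity
    rw [hAB]
    field_simp
    ring
  have hlim : Tendsto (fun r : ℝ => B / 2 * Real.arctan (r ^ 2 / B)) atTop
      (𝓝 (B / 2 * (Real.pi / 2))) := by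
    refine Tendsto.const_mul _ ?_
    exact (Real.tendsto_arctan_atTop.mono_right nhdsWithin_le_nhds).comp
      ((tendsto_pow_atTop two_ne_zero).atTop_div_const hBpos)
  have hpos : ∀ r ∈ Ioi (0 : ℝ), 0 ≤ r * (A / (r ^ 4 + A)) := fun r hr => by
    have : 0 < r := hr
    positivity
  refine ⟨integrableOn_Ioi_deriv_of_nonneg (hd 0).continuousAt.continuousWithinAt
    (fun r _ => hd r) hpos hlim, ?_⟩
  rw [integral_Ioi_of_hasDerivAt_of_nonneg (hd 0).continuousAt.continuousWithinAt
    (fun r _ => hd r) hpos hlim]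
  simp
  ring

/-- Polar coordinates: the angular factor is the dimension `2` times the unit disc's area `π`, and
`2π · (π/4)√A = (π²/2)√A`. -/
lemma integrable_and_integral_plane {A : ℝ} (hA : 0 < A) :
    Integrable (fun x : Plane => 1 - 1 / (1 + A * ‖x‖ ^ (-4 : ℝ))) ∧
      ∫ x : Plane, (1 - 1 / (1 + A * ‖x‖ ^ (-4 : ℝ))) = Real.pi ^ 2 / 2 * √A := by
  have hfr : Module.finrank ℝ Plane = 2 := by simp
  have hball : (volume : Measure Plane).real (Metric.ball 0 1) = Real.pi := by
    rw [Measure.real, EuclideanSpace.volume_ball_fin_two]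
    simp [Real.pi_pos.le]
  have hcongr : ∀ r ∈ Ioi (0 : ℝ), r ^ (Module.finrank ℝ Plane - 1) •
      (1 - 1 / (1 + A * r ^ (-4 : ℝ))) = r * (A / (r ^ 4 + A)) := fun r hr => by
    have hr : 0 < r := hr
    have h4 : r ^ (-4 : ℝ) = (r ^ 4)⁻¹ := by
      rw [Real.rpow_neg hr.le]
      norm_cast
    rw [hfr, h4, smul_eq_mul]
    have h2 : r ^ 4 + A ≠ 0 := by positivity
    have h3 : 1 + A * (r ^ 4)⁻¹ ≠ 0 := by positivity
    field_simp
    ring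
  obtain ⟨hi, hv⟩ := integrableOn_and_integral_radial hA
  constructor
  · rw [integrable_fun_norm_addHaar volume (f := fun r : ℝ => 1 - 1 / (1 + A * r ^ (-4 : ℝ)))]
    exact IntegrableOn.congr_fun hi (fun r hr => (hcongr r hr).symm) measurableSet_Ioi
  · rw [integral_fun_norm_addHaar volume (fun r : ℝ => 1 - 1 / (1 + A * r ^ (-4 : ℝ))),
      setIntegral_congr_fun measurableSet_Ioi hcongr, hv, hfr, hball]
    simp only [nsmul_eq_mul, smul_eq_mul]
    push_cast
    ring

/-! ### The Laplace transform of the interference -/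

/-- The constant `K` such that the interference has Laplace transform `s ↦ exp (-K √s)`. -/
noncomputable def Params.laplaceCoeff (θ : Params) : ℝ :=
  Real.pi ^ 2 / 2 * θ.lam * (θ.p * √θ.e1 + (1 - θ.p) * √θ.Cd)

lemma Params.laplaceCoeff_pos (θ : Params) : 0 < θ.laplaceCoeff := by
  have h1 := Real.sqrt_pos.2 θ.e1_pos
  have h2 := Real.sqrt_pos.2 θ.Cd_pos
  have h3 := θ.lam_pos
  have h4 := Real.pi_pos
  have h5 : 0 < θ.p * √θ.e1 + (1 - θ.p) * √θ.Cd := by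
    rcases θ.p_nonneg.eq_or_lt with h | h
    · rw [← h]; simpa using h2
    · have := mul_nonneg (sub_nonneg.2 θ.p_le_one) h2.le
      have := mul_pos h h1
      linarith
  unfold Params.laplaceCoeff
  positivity

lemma lintegral_one_sub_lintegral_markLaw (θ : Params) (hα : θ.α = 4) {s : ℝ} (hs : 0 < s) :
    ENNReal.ofReal θ.lam *
        ∫⁻ x, (1 - ∫⁻ m, expNeg (ENNReal.ofReal (s * interfererPower θ x m)) ∂(markLaw θ)) =
      ENNReal.ofReal (θ.laplaceCoeff * √s) := by
  have he := θ.e1_pos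
  have hC := θ.Cd_pos
  have hp0 := θ.p_nonneg
  have hp1 : 0 ≤ 1 - θ.p := by linarith [θ.p_le_one]
  obtain ⟨i1, v1⟩ := integrable_and_integral_plane (mul_pos hs he)
  obtain ⟨i2, v2⟩ := integrable_and_integral_plane (mul_pos hs hC)
  have hle : ∀ {A : ℝ} (x : Plane), 0 < A → 1 / (1 + A * ‖x‖ ^ (-4 : ℝ)) ≤ 1 := fun x hA => by
    have := Real.rpow_nonneg (norm_nonneg x) (-4)
    have := mul_nonneg hA.le this
    rw [div_le_one (by positivity)]
    linarith
  have hpt : ∀ x : Plane,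
      1 - ∫⁻ m, expNeg (ENNReal.ofReal (s * interfererPower θ x m)) ∂(markLaw θ) =
        ENNReal.ofReal (θ.p * (1 - 1 / (1 + s * θ.e1 * ‖x‖ ^ (-4 : ℝ))) +
          (1 - θ.p) * (1 - 1 / (1 + s * θ.Cd * ‖x‖ ^ (-4 : ℝ)))) := fun x => by
    have hx := Real.rpow_nonneg (norm_nonneg x) (-4)
    rw [lintegral_markLaw θ x hs.le, hα, ← ENNReal.ofReal_one, ← ENNReal.ofReal_sub _ (by positivity)]
    congr 1
    rw [← mul_assoc, ← mul_assoc]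
    ring
  simp_rw [hpt]
  rw [← ofReal_integral_eq_lintegral_ofReal
    (f := fun x : Plane => θ.p * (1 - 1 / (1 + s * θ.e1 * ‖x‖ ^ (-4 : ℝ))) +
      (1 - θ.p) * (1 - 1 / (1 + s * θ.Cd * ‖x‖ ^ (-4 : ℝ))))
    ((i1.const_mul _).add (i2.const_mul _)) (Eventually.of_forall fun x => ?_), ← ENNReal.ofReal_mul θ.lam_pos.le,
    integral_add (i1.const_mul _) (i2.const_mul _), integral_const_mul, integral_const_mul, v1, v2,
    Real.sqrt_mul hs.le, Real.sqrt_mul hs.le, Params.laplaceCoeff]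
  · congr 1; ring
  · have h1 := hle x (mul_pos hs he)
    have h2 := hle x (mul_pos hs hC)
    exact add_nonneg (mul_nonneg hp0 (sub_nonneg.2 h1)) (mul_nonneg hp1 (sub_nonneg.2 h2))

/-- Holds for divergent series as well: a non-summable real `tsum` and the `toReal` of `∞` are both
`0`. -/
lemma interference_eq_toReal {Ω : Type*} (θ : Params) (X : ℕ → Ω → Plane) (M : ℕ → Ω → Mark)
    (ω : Ω) : interference θ X M ω =
      (∑' k, ENNReal.ofReal (interfererPower θ (X k ω) (M k ω))).toReal := by
  rw [ENNReal.tsum_toReal_eq fun _ => ENNReal.ofReal_ne_top, interference]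
  simp_rw [ENNReal.toReal_ofReal (interfererPower_nonneg θ _ _)]

/-- The total interference power as a function of the configuration of marked points. -/
noncomputable def configInterference (θ : Params) (c : ℕ → Plane × Mark) : ℝ :=
  (∑' k, ENNReal.ofReal (interfererPower θ (c k).1 (c k).2)).toReal

lemma measurable_configInterference (θ : Params) : Measurable (configInterference θ) :=
  (Measurable.tsum fun k =>
    ((measurable_interfererPower θ).comp (measurable_pi_apply k)).ennreal_ofReal).ennreal_toReal

lemma IsInterferers.lintegral_expNeg {θ : Params} (hα : θ.α = 4) {X : ℕ → Ω → Plane}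
    {M : ℕ → Ω → Mark} {P : Measure Ω} [IsProbabilityMeasure P] (h : IsInterferers θ X M P)
    {s : ℝ} (hs : 0 < s) :
    ∫⁻ ω, expNeg (ENNReal.ofReal s * ∑' k, ENNReal.ofReal (interfererPower θ (X k ω) (M k ω))) ∂P =
      ENNReal.ofReal (Real.exp (-(θ.laplaceCoeff * √s))) := by
  have := isProbabilityMeasure_markLaw θ
  have hK := θ.laplaceCoeff_pos
  have key := h.hppp.lintegral_expNeg_tsum_marked h.measurable_mark (Q := markLaw θ) h.hasLaw_mark
    h.iIndep_mark h.indep (f := fun z => ENNReal.ofReal (s * interfererPower θ z.1 z.2))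
    ((measurable_interfererPower θ).const_mul s).ennreal_ofReal
  rw [lintegral_one_sub_lintegral_markLaw θ hα hs, expNeg_ofReal (by positivity)] at key
  rw [← key]
  simp_rw [ENNReal.ofReal_mul hs.le, ENNReal.tsum_mul_left]

/-- `e^{-sJ}` is at most the indicator of `J < ∞`, and its expectation tends to `1` as `s → 0`. -/
lemma ae_ne_top_of_lintegral_expNeg {P : Measure Ω} [IsProbabilityMeasure P] {J : Ω → ℝ≥0∞}
    (hJ : Measurable J) {K : ℝ}
    (h : ∀ s : ℝ, 0 < s →
      ∫⁻ ω, expNeg (ENNReal.ofReal s * J ω) ∂P = ENNReal.ofReal (Real.exp (-(K * √s)))) :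
    ∀ᵐ ω ∂P, J ω ≠ ∞ := by
  have hms : MeasurableSet {ω | J ω ≠ ∞} := (hJ (measurableSet_singleton ∞)).compl
  have hle : ∀ s : ℝ, 0 < s → ENNReal.ofReal (Real.exp (-(K * √s))) ≤ P {ω | J ω ≠ ∞} :=
    fun s hs => by
    rw [← h s hs, ← lintegral_indicator_one hms]
    refine lintegral_mono fun ω => ?_
    by_cases hω : J ω = ∞
    · have : (0 : ℝ≥0∞) ≠ ENNReal.ofReal s := (ENNReal.ofReal_pos.2 hs).ne
      simp [hω, ENNReal.mul_top this.symm, expNeg_top]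
    · simpa [indicator, hω] using expNeg_le_one _
  have hlim : Tendsto (fun s : ℝ => ENNReal.ofReal (Real.exp (-(K * √s)))) (𝓝[>] 0) (𝓝 1) := by
    have hc : Continuous fun s : ℝ => ENNReal.ofReal (Real.exp (-(K * √s))) :=
      ENNReal.continuous_ofReal.comp (by fun_prop)
    exact (hc.tendsto' 0 1 (by simp)).mono_left nhdsWithin_le_nhds
  have h1 : 1 ≤ P {ω | J ω ≠ ∞} := le_of_tendsto hlim (by
    filter_upwards [self_mem_nhdsWithin] with s hs using hle s hs)
  exact (prob_compl_eq_zero_iff hms).2 (le_antisymm prob_le_one h1)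

/-- `e^{-sJ}` dominates the indicator of `J = 0`, and its expectation tends to `0` as `s → ∞`
because `K > 0`. -/
lemma ae_ne_zero_of_lintegral_expNeg {P : Measure Ω} {J : Ω → ℝ≥0∞}
    (hJ : Measurable J) {K : ℝ} (hK : 0 < K)
    (h : ∀ s : ℝ, 0 < s →
      ∫⁻ ω, expNeg (ENNReal.ofReal s * J ω) ∂P = ENNReal.ofReal (Real.exp (-(K * √s)))) :
    ∀ᵐ ω ∂P, J ω ≠ 0 := by
  have hms : MeasurableSet {ω | J ω = 0} := hJ (measurableSet_singleton 0)
  have hle : ∀ s : ℝ, 0 < s → P {ω | J ω = 0} ≤ ENNReal.ofReal (Real.exp (-(K * √s))) :=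
    fun s hs => by
    rw [← h s hs, ← lintegral_indicator_one hms]
    refine lintegral_mono fun ω => ?_
    by_cases hω : J ω = 0
    · simp [hω, expNeg_zero]
    · simp [indicator, hω]
  have hlim : Tendsto (fun s : ℝ => ENNReal.ofReal (Real.exp (-(K * √s)))) atTop (𝓝 0) := by
    have h1 : Tendsto (fun s : ℝ => Real.exp (-(K * √s))) atTop (𝓝 0) :=
      Real.tendsto_exp_neg_atTop_nhds_zero.comp (Real.tendsto_sqrt_atTop.const_mul_atTop hK)
    simpa [Function.comp_def] using (ENNReal.continuous_ofReal.tendsto 0).comp h1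
  have h1 : P {ω | J ω = 0} ≤ 0 := ge_of_tendsto hlim (by
    filter_upwards [eventually_gt_atTop 0] with s hs using hle s hs)
  rw [ae_iff]
  simpa using h1

lemma IsInterferers.measurable_tsum {θ : Params} {X : ℕ → Ω → Plane}
    {M : ℕ → Ω → Mark} {P : Measure Ω} (h : IsInterferers θ X M P) :
    Measurable fun ω => ∑' k, ENNReal.ofReal (interfererPower θ (X k ω) (M k ω)) :=
  Measurable.tsum fun k => ((measurable_interfererPower θ).comp
    ((h.hppp.measurable k).prodMk (h.measurable_mark k))).ennreal_ofReal

lemma IsInterferers.measurable_interference {θ : Params} {X : ℕ → Ω → Plane}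
    {M : ℕ → Ω → Mark} {P : Measure Ω} (h : IsInterferers θ X M P) :
    Measurable (interference θ X M) := by
  simp_rw [funext (interference_eq_toReal θ X M)]
  exact h.measurable_tsum.ennreal_toReal

lemma IsInterferers.ae_interference_pos {θ : Params} (hα : θ.α = 4) {X : ℕ → Ω → Plane}
    {M : ℕ → Ω → Mark} {P : Measure Ω} [IsProbabilityMeasure P] (h : IsInterferers θ X M P) :
    ∀ᵐ ω ∂P, 0 < interference θ X M ω := by
  filter_upwards [ae_ne_top_of_lintegral_expNeg h.measurable_tsum fun s hs =>
      h.lintegral_expNeg hα hs,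
    ae_ne_zero_of_lintegral_expNeg h.measurable_tsum θ.laplaceCoeff_pos fun s hs =>
      h.lintegral_expNeg hα hs] with ω h1 h2
  rw [interference_eq_toReal]
  exact ENNReal.toReal_pos h2 h1

lemma IsInterferers.lintegral_exp_neg_interference {θ : Params} (hα : θ.α = 4)
    {X : ℕ → Ω → Plane} {M : ℕ → Ω → Mark} {P : Measure Ω} [IsProbabilityMeasure P]
    (h : IsInterferers θ X M P) {s : ℝ} (hs : 0 < s) :
    ∫⁻ ω, ENNReal.ofReal (Real.exp (-(s * interference θ X M ω))) ∂P =
      ENNReal.ofReal (Real.exp (-(θ.laplaceCoeff * √s))) := by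
  rw [← h.lintegral_expNeg hα hs]
  refine lintegral_congr_ae ?_
  filter_upwards [ae_ne_top_of_lintegral_expNeg h.measurable_tsum fun s hs =>
      h.lintegral_expNeg hα hs] with ω hω
  rw [interference_eq_toReal, ← expNeg_ofReal (by positivity), ENNReal.ofReal_mul hs.le,
    ENNReal.ofReal_toReal hω]

/-! ### The signal power of Rayleigh fading -/

lemma lintegral_Ioi_mul_exp_neg_sq {R : ℝ} (hR : 0 ≤ R) :
    ∫⁻ r in Ioi (√R), ENNReal.ofReal (r * Real.exp (-r ^ 2)) =
      ENNReal.ofReal (Real.exp (-R) / 2) := by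
  have hd : ∀ r : ℝ, HasDerivAt (fun r : ℝ => -(Real.exp (-r ^ 2) / 2)) (r * Real.exp (-r ^ 2)) r :=
    fun r => by
    have h1 : HasDerivAt (fun r : ℝ => -r ^ 2) (-(2 * r)) r := by
      simpa using (hasDerivAt_pow 2 r).fun_neg
    refine ((h1.exp.div_const 2).neg).congr_deriv (by ring)
  have hlim : Tendsto (fun r : ℝ => -(Real.exp (-r ^ 2) / 2)) atTop (𝓝 0) := by
    have h1 : Tendsto (fun r : ℝ => Real.exp (-r ^ 2)) atTop (𝓝 0) :=
      Real.tendsto_exp_neg_atTop_nhds_zero.comp (tendsto_pow_atTop two_ne_zero)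
    simpa using (h1.div_const 2).neg
  have hpos : ∀ r ∈ Ioi (√R), 0 ≤ r * Real.exp (-r ^ 2) := fun r hr => by
    have : 0 < r := (Real.sqrt_nonneg R).trans_lt hr
    positivity
  rw [← ofReal_integral_eq_lintegral_ofReal
    (integrableOn_Ioi_deriv_of_nonneg (hd _).continuousAt.continuousWithinAt (fun r _ => hd r) hpos
      hlim) ((ae_restrict_iff' measurableSet_Ioi).2 (Eventually.of_forall hpos)),
    integral_Ioi_of_hasDerivAt_of_nonneg (hd _).continuousAt.continuousWithinAt (fun r _ => hd r)
      hpos hlim, Real.sq_sqrt hR]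
  congr 1
  ring

/-- Each component has density `π^{-1/2} e^{-x²}`, so the joint density is radial and polar
coordinates give an exponential tail. -/
lemma complexNormal_one_norm_sq_gt {R : ℝ} (hR : 0 ≤ R) :
    complexNormal 1 {z | R < ‖z‖ ^ 2} = ENNReal.ofReal (Real.exp (-R)) := by
  have hms : MeasurableSet {z : ℂ | R < ‖z‖ ^ 2} := measurableSet_lt (by fun_prop) (by fun_prop)
  have hhalf : ((1 : ℝ≥0) / 2) ≠ 0 := by simp
  have hdens : ∀ x : ℝ, gaussianPDF 0 (1 / 2) x =
      ENNReal.ofReal ((√Real.pi)⁻¹ * Real.exp (-x ^ 2)) := fun x => by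
    rw [gaussianPDF, gaussianPDFReal]
    congr 3
    · push_cast; ring_nf
    · push_cast; ring_nf
  rw [complexNormal, Measure.map_apply measurable_complex_mk hms,
    gaussianReal_of_var_ne_zero _ hhalf, prod_withDensity (by fun_prop) (by fun_prop),
    withDensity_apply _ (measurable_complex_mk hms), ← lintegral_indicator (measurable_complex_mk hms)]
  have h1 : ∀ z : ℝ × ℝ, ((fun z : ℝ × ℝ => (⟨z.1, z.2⟩ : ℂ)) ⁻¹' {z | R < ‖z‖ ^ 2}).indicator
      (fun z => gaussianPDF 0 (1 / 2) z.1 * gaussianPDF 0 (1 / 2) z.2) z =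
      {z : ℝ × ℝ | R < z.1 ^ 2 + z.2 ^ 2}.indicator
        (fun z => ENNReal.ofReal (Real.pi⁻¹ * Real.exp (-(z.1 ^ 2 + z.2 ^ 2)))) z := fun z => by
    have hset : (fun z : ℝ × ℝ => (⟨z.1, z.2⟩ : ℂ)) ⁻¹' {z | R < ‖z‖ ^ 2} =
        {z : ℝ × ℝ | R < z.1 ^ 2 + z.2 ^ 2} := by
      ext z
      rw [mem_preimage, mem_ofPred_eq, mem_ofPred_eq, Complex.sq_norm, Complex.normSq_apply]
      simp only [sq]
    rw [hset]
    congr 1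
    ext z
    rw [hdens, hdens, ← ENNReal.ofReal_mul (by positivity)]
    congr 1
    have hpi : (√Real.pi)⁻¹ * (√Real.pi)⁻¹ = Real.pi⁻¹ := by
      rw [← mul_inv, Real.mul_self_sqrt Real.pi_pos.le]
    rw [neg_add, Real.exp_add, ← hpi]
    ring
  simp_rw [← Measure.volume_eq_prod, h1]
  rw [← lintegral_comp_polarCoord_symm]
  have h2 : ∀ q ∈ polarCoord.target, ENNReal.ofReal q.1 •
      {z : ℝ × ℝ | R < z.1 ^ 2 + z.2 ^ 2}.indicator
        (fun z => ENNReal.ofReal (Real.pi⁻¹ * Real.exp (-(z.1 ^ 2 + z.2 ^ 2)))) (polarCoord.symm q) =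
      (Ioi (√R)).indicator (fun r => ENNReal.ofReal (r * Real.exp (-r ^ 2))) q.1 *
        ENNReal.ofReal Real.pi⁻¹ := fun q hq => by
    have hq1 : 0 < q.1 := by
      rw [polarCoord_target] at hq
      exact hq.1
    have hsq : (polarCoord.symm q).1 ^ 2 + (polarCoord.symm q).2 ^ 2 = q.1 ^ 2 := by
      rw [polarCoord_symm_apply]
      linear_combination q.1 ^ 2 * Real.sin_sq_add_cos_sq q.2
    by_cases hqR : √R < q.1
    · have : R < q.1 ^ 2 := (Real.sqrt_lt' hq1).1 hqR
      rw [indicator_of_mem (by rw [mem_ofPred_eq, hsq]; exact this), indicator_of_mem (mem_Ioi.2 hqR), hsq,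
        smul_eq_mul, ← ENNReal.ofReal_mul hq1.le, ← ENNReal.ofReal_mul (by positivity)]
      congr 1
      ring
    · have : ¬ R < q.1 ^ 2 := fun h => hqR ((Real.sqrt_lt' hq1).2 h)
      rw [indicator_of_notMem (by rw [mem_ofPred_eq, hsq]; exact this),
        indicator_of_notMem (fun h => hqR (mem_Ioi.1 h))]
      simp
  rw [setLIntegral_congr_fun (by rw [polarCoord_target]; measurability) h2, polarCoord_target,
    Measure.volume_eq_prod, ← Measure.prod_restrict, lintegral_prod_mul
      (f := (Ioi (√R)).indicator fun r => ENNReal.ofReal (r * Real.exp (-r ^ 2)))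
      (g := fun _ => ENNReal.ofReal Real.pi⁻¹)]
  · rw [lintegral_const, Measure.restrict_apply_univ, Real.volume_Ioo,
      lintegral_indicator measurableSet_Ioi, Measure.restrict_restrict measurableSet_Ioi,
      inter_eq_left.2 (Ioi_subset_Ioi (Real.sqrt_nonneg R)), lintegral_Ioi_mul_exp_neg_sq hR,
      ← ENNReal.ofReal_mul (by positivity), ← ENNReal.ofReal_mul (by positivity)]
    congr 1
    have := Real.pi_pos
    field_simp
    ring
  · exact (Measurable.indicator (by fun_prop) measurableSet_Ioi).aemeasurable
  · exact aemeasurable_const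

lemma Params.etaG0_pos (θ : Params) : 0 < θ.etaG0 :=
  mul_pos θ.Cd_pos (Real.rpow_pos_of_pos θ.dg0_pos _)

lemma hasLaw_signalDirect (θ : Params) {P : Measure Ω} [IsProbabilityMeasure P] {g : Ω → ℂ}
    (hg : HasLaw g (complexNormal 1) P) :
    HasLaw (signalDirect θ g) (gammaMeasure 1 (1 / θ.etaG0)) P := by
  have hη := θ.etaG0_pos
  have hm : Measurable fun z : ℂ => θ.etaG0 * ‖z‖ ^ 2 := by fun_prop
  have haem : AEMeasurable (signalDirect θ g) P := hm.comp_aemeasurable hg.aemeasurable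
  refine ⟨haem, ?_⟩
  have := Measure.isProbabilityMeasure_map haem
  have hr : 0 < 1 / θ.etaG0 := by positivity
  have := isProbabilityMeasure_expMeasure hr
  -- `expMeasure` is by definition `gammaMeasure` of shape `1`; the laws are then compared through
  -- their distribution functions.
  change P.map (signalDirect θ g) = expMeasure (1 / θ.etaG0)
  refine Measure.eq_of_cdf _ _ ?_
  ext x
  rw [cdf_expMeasure_eq hr, cdf_eq_real, map_measureReal_apply_of_aemeasurable haem measurableSet_Iic]
  have hcomp : signalDirect θ g ⁻¹' Iic x = g ⁻¹' {z | θ.etaG0 * ‖z‖ ^ 2 ≤ x} := rfl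
  have hms : MeasurableSet {z : ℂ | θ.etaG0 * ‖z‖ ^ 2 ≤ x} := measurableSet_le hm measurable_const
  rw [hcomp, ← map_measureReal_apply_of_aemeasurable hg.aemeasurable hms, hg.map_eq]
  split_ifs with hx
  · have hset : {z : ℂ | θ.etaG0 * ‖z‖ ^ 2 ≤ x} = {z | x / θ.etaG0 < ‖z‖ ^ 2}ᶜ := by
      ext z
      simp only [mem_ofPred_eq, mem_compl_iff, not_lt]
      rw [le_div_iff₀ hη, mul_comm]
    rw [hset, measureReal_compl (measurableSet_lt (by fun_prop) (by fun_prop)), Measure.real,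
      Measure.real, complexNormal_one_norm_sq_gt (by positivity),
      ENNReal.toReal_ofReal (Real.exp_pos _).le, measure_univ]
    simp [div_eq_inv_mul]
  · have hset : {z : ℂ | θ.etaG0 * ‖z‖ ^ 2 ≤ x} = ∅ := by
      ext z
      simp only [mem_ofPred_eq, mem_empty_iff_false, iff_false, not_le]
      push Not at hx
      exact hx.trans_le (by positivity)
    rw [hset]
    simp

/-! ### The tail of the gamma law with an integer shape -/

/-- The tail `∑_{i<k} xⁱ e^{-x} / i!` of the gamma law with shape `k` and rate `1`. -/
noncomputable def erlangTail (k : ℕ) (x : ℝ) : ℝ :=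
  ∑ i ∈ Finset.range k, x ^ i / (i.factorial : ℝ) * Real.exp (-x)

lemma continuous_erlangTail (k : ℕ) : Continuous (erlangTail k) := by
  unfold erlangTail
  fun_prop

lemma erlangTail_nonneg (k : ℕ) {x : ℝ} (hx : 0 ≤ x) : 0 ≤ erlangTail k x :=
  Finset.sum_nonneg fun i _ => by positivity

lemma erlangTail_succ_zero (n : ℕ) : erlangTail (n + 1) 0 = 1 := by
  rw [erlangTail, Finset.sum_range_succ']
  simp

/-- The derivative telescopes: differentiating each power cancels the exponential part of the
preceding term, so only the last one survives. -/
lemma hasDerivAt_erlangTail_succ (n : ℕ) (x : ℝ) :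
    HasDerivAt (erlangTail (n + 1)) (-(x ^ n / (n.factorial : ℝ) * Real.exp (-x))) x := by
  have he : HasDerivAt (fun x : ℝ => Real.exp (-x)) (Real.exp (-x) * -1) x :=
    (hasDerivAt_neg x).exp
  induction n with
  | zero =>
    refine (he.congr_of_eventuallyEq ?_).congr_deriv (by simp)
    exact Eventually.of_forall fun y => by simp [erlangTail]
  | succ n ih =>
    have h1 : HasDerivAt (fun x : ℝ => x ^ (n + 1) / ((n + 1).factorial : ℝ) * Real.exp (-x)) _ x :=
      ((hasDerivAt_pow (n + 1) x).div_const _).mul he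
    have h2 : erlangTail (n + 1 + 1) = fun x => erlangTail (n + 1) x +
        x ^ (n + 1) / ((n + 1).factorial : ℝ) * Real.exp (-x) := by
      ext x
      rw [erlangTail, Finset.sum_range_succ, erlangTail]
    rw [h2]
    refine (ih.add h1).congr_deriv ?_
    have hf : (n.factorial : ℝ) ≠ 0 := by positivity
    rw [Nat.factorial_succ]
    push_cast
    have hn : (n : ℝ) + 1 ≠ 0 := by positivity
    field_simp
    ring

lemma tendsto_erlangTail_atTop (k : ℕ) : Tendsto (erlangTail k) atTop (𝓝 0) := by
  have h : Tendsto (fun x : ℝ => ∑ i ∈ Finset.range k,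
      (i.factorial : ℝ)⁻¹ * (x ^ i * Real.exp (-x))) atTop
      (𝓝 (∑ i ∈ Finset.range k, (i.factorial : ℝ)⁻¹ * 0)) :=
    tendsto_finsetSum _ fun i _ => (Real.tendsto_pow_mul_exp_neg_atTop_nhds_zero i).const_mul _
  simp only [mul_zero, Finset.sum_const_zero] at h
  refine h.congr fun x => Finset.sum_congr rfl fun i _ => ?_
  field_simp

/-- For integer shape, `-erlangTail` after rescaling is a primitive of the gamma density that
vanishes at infinity. -/
lemma gammaMeasure_Ioi {k : ℕ} (hk : 0 < k) {r : ℝ} (hr : 0 < r) {x : ℝ} (hx : 0 ≤ x) :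
    gammaMeasure k r (Ioi x) = ENNReal.ofReal (erlangTail k (r * x)) := by
  obtain ⟨n, rfl⟩ := Nat.exists_eq_succ_of_ne_zero hk.ne'
  have hpdf : ∀ y ∈ Ioi x, gammaPDF ((n + 1 : ℕ) : ℝ) r y =
      ENNReal.ofReal (r * ((r * y) ^ n / (n.factorial : ℝ) * Real.exp (-(r * y)))) := fun y hy => by
    have hy : 0 < y := hx.trans_lt hy
    rw [gammaPDF, gammaPDFReal, if_pos hy.le]
    congr 1
    have h1 : ((n + 1 : ℕ) : ℝ) - 1 = n := by push_cast; ring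
    rw [h1, Real.rpow_natCast, Real.rpow_natCast, Nat.cast_succ, Real.Gamma_nat_eq_factorial,
      pow_succ, mul_pow]
    ring
  have hd : ∀ y, HasDerivAt (fun y => -erlangTail (n + 1) (r * y))
      (r * ((r * y) ^ n / (n.factorial : ℝ) * Real.exp (-(r * y)))) y := fun y => by
    have h1 : HasDerivAt (fun y => r * y) r y := by simpa using (hasDerivAt_id y).const_mul r
    refine ((hasDerivAt_erlangTail_succ n (r * y)).comp y h1).fun_neg.congr_deriv ?_
    ring
  have hpos : ∀ y ∈ Ioi x, 0 ≤ r * ((r * y) ^ n / (n.factorial : ℝ) * Real.exp (-(r * y))) :=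
    fun y hy => by
      have hy : 0 < y := hx.trans_lt hy
      positivity
  have hlim : Tendsto (fun y => -erlangTail (n + 1) (r * y)) atTop (𝓝 0) := by
    simpa [Function.comp_def] using
      ((tendsto_erlangTail_atTop (n + 1)).comp (tendsto_id.const_mul_atTop hr)).neg
  rw [gammaMeasure, withDensity_apply _ measurableSet_Ioi,
    setLIntegral_congr_fun measurableSet_Ioi hpdf, ← ofReal_integral_eq_lintegral_ofReal
    (integrableOn_Ioi_deriv_of_nonneg (hd _).continuousAt.continuousWithinAt (fun y _ => hd y) hpos
      hlim) ((ae_restrict_iff' measurableSet_Ioi).2 (Eventually.of_forall hpos)),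
    integral_Ioi_of_hasDerivAt_of_nonneg (hd _).continuousAt.continuousWithinAt (fun y _ => hd y)
      hpos hlim]
  simp

/-! ### The ratio of a gamma variable and an independent positive variable -/

section Ratio

variable {P : Measure Ω} [IsProbabilityMeasure P]

lemma measure_prodMk_mem_of_indepFun {S I : Ω → ℝ} (hS : Measurable S) (hI : Measurable I)
    (h : IndepFun S I P) {B : Set (ℝ × ℝ)} (hB : MeasurableSet B) :
    P {ω | (S ω, I ω) ∈ B} = ∫⁻ ω, P.map S {x | (x, I ω) ∈ B} ∂P := by
  have := Measure.isProbabilityMeasure_map (μ := P) hS.aemeasurable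
  have := Measure.isProbabilityMeasure_map (μ := P) hI.aemeasurable
  have h1 : P {ω | (S ω, I ω) ∈ B} = P.map (fun ω => (S ω, I ω)) B :=
    (Measure.map_apply (hS.prodMk hI) hB).symm
  rw [h1, (indepFun_iff_map_prod_eq_prod_map_map hS.aemeasurable hI.aemeasurable).1 h,
    Measure.prod_apply_symm hB, lintegral_map (measurable_measure_prodMk_right hB) hI]
  rfl

lemma sinr_zero_eq {Ω : Type*} (S I : Ω → ℝ) : sinr S I 0 = fun ω => S ω / I ω := by
  ext ω
  simp [sinr]

lemma measurable_sinr {S I : Ω → ℝ} (hS : Measurable S) (hI : Measurable I) (ν : ℝ) :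
    Measurable (sinr S I ν) := hS.div (hI.add_const ν)

/-- Conditionally on `I = i > 0` the ratio is a rescaling of `S`, and rescaling preserves
Lebesgue-null sets. -/
lemma hasPDF_sinr_zero {S I : Ω → ℝ} (hS : Measurable S) (hI : Measurable I)
    (h : IndepFun S I P) (hac : P.map S ≪ volume) (hpos : ∀ᵐ ω ∂P, 0 < I ω) :
    HasPDF (sinr S I 0) P volume := by
  have hm := measurable_sinr hS hI 0
  have := Measure.isProbabilityMeasure_map (μ := P) hm.aemeasurable
  refine hasPDF_iff.2 ⟨hm.aemeasurable, inferInstance, Measure.AbsolutelyContinuous.mk fun s hs h0 => ?_⟩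
  have hB : MeasurableSet {z : ℝ × ℝ | z.1 / z.2 ∈ s} := (measurable_fst.div measurable_snd) hs
  rw [Measure.map_apply hm hs, sinr_zero_eq]
  refine (measure_prodMk_mem_of_indepFun hS hI h hB).trans ?_
  refine (lintegral_congr_ae ?_).trans lintegral_zero
  filter_upwards [hpos] with ω hω
  refine hac ?_
  have h1 : {x : ℝ | x / I ω ∈ s} = (fun x => x * (I ω)⁻¹) ⁻¹' s := by
    ext x; simp [div_eq_mul_inv]
  have h2 := Real.volume_preimage_mul_right (a := (I ω)⁻¹) (inv_ne_zero hω.ne') s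
  rw [h0, mul_zero] at h2
  exact (congrArg volume h1).trans h2

lemma measure_lt_sinr_zero {k : ℕ} (hk : 0 < k) {r : ℝ} (hr : 0 < r) {S I : Ω → ℝ}
    (hS : Measurable S) (hI : Measurable I) (h : IndepFun S I P)
    (hlaw : HasLaw S (gammaMeasure k r) P) (hpos : ∀ᵐ ω ∂P, 0 < I ω) {t : ℝ} (ht : 0 ≤ t) :
    P {ω | t < sinr S I 0 ω} = ∫⁻ ω, ENNReal.ofReal (erlangTail k (r * (t * I ω))) ∂P := by
  have hB : MeasurableSet {z : ℝ × ℝ | t * z.2 < z.1} :=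
    measurableSet_lt (by fun_prop) (by fun_prop)
  have h1 : P {ω | t < sinr S I 0 ω} = P {ω | t * I ω < S ω} := by
    refine measure_congr ?_
    filter_upwards [hpos] with ω hω
    refine propext ?_
    change t < sinr S I 0 ω ↔ t * I ω < S ω
    rw [sinr_zero_eq, lt_div_iff₀ hω]
  rw [h1]
  refine (measure_prodMk_mem_of_indepFun hS hI h hB).trans (lintegral_congr_ae ?_)
  filter_upwards [hpos] with ω hω
  rw [hlaw.map_eq, ← gammaMeasure_Ioi hk hr (by positivity)]
  rfl

lemma ae_sinr_zero_pos {k : ℕ} (hk : 0 < k) {r : ℝ} (hr : 0 < r) {S I : Ω → ℝ}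
    (hS : Measurable S) (hI : Measurable I) (h : IndepFun S I P)
    (hlaw : HasLaw S (gammaMeasure k r) P) (hpos : ∀ᵐ ω ∂P, 0 < I ω) :
    ∀ᵐ ω ∂P, 0 < sinr S I 0 ω := by
  -- At threshold `t = 0` the tail equals `1` identically.
  have h1 := measure_lt_sinr_zero hk hr hS hI h hlaw hpos le_rfl
  obtain ⟨n, rfl⟩ := Nat.exists_eq_succ_of_ne_zero hk.ne'
  simp only [zero_mul, mul_zero, Nat.succ_eq_add_one, erlangTail_succ_zero, ENNReal.ofReal_one,
    lintegral_one, measure_univ] at h1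
  exact (prob_compl_eq_zero_iff
    (measurableSet_lt measurable_const (measurable_sinr hS hI 0))).2 h1

/-! ### The Laplace transform averaged against `dt / (1 + t)` -/

/-- The measure `dt / (1 + t)` on `(0, ∞)`. -/
noncomputable def rateMeasure : Measure ℝ :=
  (volume.restrict (Ioi 0)).withDensity fun t => ENNReal.ofReal (1 + t)⁻¹

instance sFinite_rateMeasure : SFinite rateMeasure := by
  unfold rateMeasure
  infer_instance

lemma lintegral_rateMeasure {f : ℝ → ℝ≥0∞} (hf : Measurable f) :
    ∫⁻ t, f t ∂rateMeasure = ∫⁻ t in Ioi 0, f t * ENNReal.ofReal (1 + t)⁻¹ := by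
  rw [rateMeasure, lintegral_withDensity_eq_lintegral_mul _ (by fun_prop) hf]
  simp_rw [Pi.mul_apply, mul_comm]

/-- Fubini: integrating over `ω` first gives the Laplace transform at `ct`, and `√(ct) = √c √t`
leaves the integral defining `rateFun`. -/
lemma lintegral_exp_neg_prod_rateMeasure {I : Ω → ℝ} (hI : Measurable I) {K : ℝ} (hK : 0 < K)
    (hL : ∀ s : ℝ, 0 < s →
      ∫⁻ ω, ENNReal.ofReal (Real.exp (-(s * I ω))) ∂P = ENNReal.ofReal (Real.exp (-(K * √s))))
    {c : ℝ} (hc : 0 < c) :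
    ∫⁻ z, ENNReal.ofReal (Real.exp (-(c * (z.2 * I z.1)))) ∂(P.prod rateMeasure) =
      ENNReal.ofReal (rateFun (K * √c)) := by
  have hV : 0 < K * √c := mul_pos hK (Real.sqrt_pos.2 hc)
  have hm : Measurable fun z : Ω × ℝ => ENNReal.ofReal (Real.exp (-(c * (z.2 * I z.1)))) := by
    fun_prop
  obtain ⟨hi, hv⟩ := rateFun_integral_aux hV
  rw [lintegral_prod_symm _ hm.aemeasurable, lintegral_rateMeasure hm.lintegral_prod_left', ← hv,
    ofReal_integral_eq_lintegral_ofReal hi]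
  · refine setLIntegral_congr_fun measurableSet_Ioi fun t ht => ?_
    have ht : 0 < t := ht
    have h1 := hL (c * t) (by positivity)
    rw [Real.sqrt_mul hc.le, ← mul_assoc] at h1
    simp_rw [← mul_assoc]
    rw [h1, ← ENNReal.ofReal_mul (Real.exp_pos _).le]
  · filter_upwards [ae_restrict_mem measurableSet_Ioi] with t ht
    have ht : 0 < t := ht
    simp only [Pi.zero_apply]
    positivity

/-! ### The averaged Laplace transform as a moment generating function -/

section Rate

variable {I : Ω → ℝ} {K r : ℝ}

lemma integrable_exp_prod_rateMeasure (hI : Measurable I) (hK : 0 < K) (hr : 0 < r)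
    (hL : ∀ s : ℝ, 0 < s →
      ∫⁻ ω, ENNReal.ofReal (Real.exp (-(s * I ω))) ∂P = ENNReal.ofReal (Real.exp (-(K * √s))))
    {s : ℝ} (hs : 0 < s) :
    Integrable (fun z : Ω × ℝ => Real.exp (s * -(r * (z.2 * I z.1)))) (P.prod rateMeasure) ∧
      mgf (fun z : Ω × ℝ => -(r * (z.2 * I z.1))) (P.prod rateMeasure) s =
        rateFun (K * √(r * s)) := by
  have hc : 0 < r * s := mul_pos hr hs
  have h1 := lintegral_exp_neg_prod_rateMeasure hI hK hL hc
  have h2 : ∀ z : Ω × ℝ, -(r * s * (z.2 * I z.1)) = s * -(r * (z.2 * I z.1)) := fun z => by ring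
  simp_rw [h2] at h1
  have hm : Measurable fun z : Ω × ℝ => Real.exp (s * -(r * (z.2 * I z.1))) := by fun_prop
  have hnn : 0 ≤ᵐ[P.prod rateMeasure] fun z : Ω × ℝ => Real.exp (s * -(r * (z.2 * I z.1))) :=
    Eventually.of_forall fun z => (Real.exp_pos _).le
  have hi : Integrable (fun z : Ω × ℝ => Real.exp (s * -(r * (z.2 * I z.1))))
      (P.prod rateMeasure) := by
    refine ⟨hm.aestronglyMeasurable, ?_⟩
    rw [hasFiniteIntegral_iff_ofReal hnn, h1]
    exact ENNReal.ofReal_lt_top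
  refine ⟨hi, ?_⟩
  rw [mgf, integral_eq_lintegral_of_nonneg_ae hnn hm.aestronglyMeasurable, h1,
    ENNReal.toReal_ofReal]
  rw [← (rateFun_integral_aux (mul_pos hK (Real.sqrt_pos.2 hc))).2]
  refine setIntegral_nonneg measurableSet_Ioi fun t ht => ?_
  have ht : 0 < t := ht
  positivity

/-- `rateMeasure` has infinite mass, so the transform diverges at `s = 0`, but it is finite on all
of `(0, ∞)`, a neighbourhood of `1`. -/
lemma one_mem_interior_integrableExpSet (hI : Measurable I) (hK : 0 < K) (hr : 0 < r)
    (hL : ∀ s : ℝ, 0 < s →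
      ∫⁻ ω, ENNReal.ofReal (Real.exp (-(s * I ω))) ∂P = ENNReal.ofReal (Real.exp (-(K * √s)))) :
    1 ∈ interior (integrableExpSet (fun z : Ω × ℝ => -(r * (z.2 * I z.1)))
      (P.prod rateMeasure)) :=
  interior_maximal (fun _ hs => (integrable_exp_prod_rateMeasure hI hK hr hL hs).1) isOpen_Ioi
    (mem_Ioi.2 one_pos)

lemma eventuallyEq_mgf_rateFun (hI : Measurable I) (hK : 0 < K) (hr : 0 < r)
    (hL : ∀ s : ℝ, 0 < s →
      ∫⁻ ω, ENNReal.ofReal (Real.exp (-(s * I ω))) ∂P = ENNReal.ofReal (Real.exp (-(K * √s)))) :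
    (fun s => rateFun (K * √(r * s))) =ᶠ[𝓝 1]
      mgf (fun z : Ω × ℝ => -(r * (z.2 * I z.1))) (P.prod rateMeasure) := by
  filter_upwards [Ioi_mem_nhds (zero_lt_one' ℝ)] with s hs
  exact (integrable_exp_prod_rateMeasure hI hK hr hL hs).2.symm

lemma contDiffAt_rateFun (hI : Measurable I) (hK : 0 < K) (hr : 0 < r)
    (hL : ∀ s : ℝ, 0 < s →
      ∫⁻ ω, ENNReal.ofReal (Real.exp (-(s * I ω))) ∂P = ENNReal.ofReal (Real.exp (-(K * √s))))
    (n : WithTop ℕ∞) :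
    ContDiffAt ℝ n (fun s => rateFun (K * √(r * s))) 1 :=
  (analyticAt_mgf (one_mem_interior_integrableExpSet hI hK hr hL)).contDiffAt.congr_of_eventuallyEq
    (eventuallyEq_mgf_rateFun hI hK hr hL)

/-- Sign bookkeeping: `(-x)ⁱ e^{-x}` is the `i`-th derivative of `s ↦ e^{-sx}` at `1`. -/
lemma erlangTail_eq_sum_neg_pow (k : ℕ) (x : ℝ) :
    erlangTail k x = ∑ i ∈ Finset.range k,
      (-1 : ℝ) ^ i / (i.factorial : ℝ) * ((-x) ^ i * Real.exp (1 * -x)) := by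
  refine Finset.sum_congr rfl fun i _ => ?_
  have : (-1 : ℝ) ^ i * (-x) ^ i = x ^ i := by rw [← mul_pow]; simp
  rw [one_mul, ← this]
  ring

lemma integral_erlangTail_prod_rateMeasure (hI : Measurable I) (hK : 0 < K) (hr : 0 < r)
    (hL : ∀ s : ℝ, 0 < s →
      ∫⁻ ω, ENNReal.ofReal (Real.exp (-(s * I ω))) ∂P = ENNReal.ofReal (Real.exp (-(K * √s))))
    (k : ℕ) :
    Integrable (fun z : Ω × ℝ => erlangTail k (r * (z.2 * I z.1))) (P.prod rateMeasure) ∧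
      ∫ z, erlangTail k (r * (z.2 * I z.1)) ∂(P.prod rateMeasure) =
        ∑ i ∈ Finset.range k, (-1 : ℝ) ^ i / (i.factorial : ℝ) *
          iteratedDeriv i (fun s => rateFun (K * √(r * s))) 1 := by
  have h1 := one_mem_interior_integrableExpSet hI hK hr hL
  have hint : ∀ i ∈ Finset.range k, Integrable (fun z : Ω × ℝ =>
      (-1 : ℝ) ^ i / (i.factorial : ℝ) * ((-(r * (z.2 * I z.1))) ^ i *
        Real.exp (1 * -(r * (z.2 * I z.1))))) (P.prod rateMeasure) := fun i _ =>
    (integrable_pow_mul_exp_of_mem_interior_integrableExpSet h1 i).const_mul _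
  simp_rw [erlangTail_eq_sum_neg_pow]
  refine ⟨integrable_finsetSum _ hint, ?_⟩
  rw [integral_finsetSum _ hint]
  refine Finset.sum_congr rfl fun i _ => ?_
  rw [integral_const_mul, (eventuallyEq_mgf_rateFun hI hK hr hL).iteratedDeriv_eq i,
    iteratedDeriv_mgf h1]

/-! ### Layer-cake formula for the expected logarithm, and the rate as an expectation -/

lemma integral_inv_one_add {x : ℝ} (hx : 0 ≤ x) :
    ∫ t in (0 : ℝ)..x, (1 + t)⁻¹ = Real.log (1 + x) := by
  have hd : ∀ t ∈ uIcc 0 x, HasDerivAt (fun t : ℝ => Real.log (1 + t)) (1 + t)⁻¹ t := fun t ht => by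
    rw [uIcc_of_le hx] at ht
    have h0 : 1 + t ≠ 0 := by linarith [ht.1]
    simpa using ((hasDerivAt_id t).const_add 1).log h0
  rw [intervalIntegral.integral_eq_sub_of_hasDerivAt hd]
  · simp
  · refine ContinuousOn.intervalIntegrable (ContinuousOn.inv₀ (by fun_prop) fun t ht => ?_)
    rw [uIcc_of_le hx] at ht
    linarith [ht.1]

/-- The expected logarithm of one plus a ratio of a gamma variable with integer shape and an
independent variable with Laplace transform `exp (-K √s)`. -/
lemma integral_log_one_add_sinr {k : ℕ} (hk : 0 < k) {S : Ω → ℝ}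
    (hS : Measurable S) (hI : Measurable I) (h : IndepFun S I P)
    (hlaw : HasLaw S (gammaMeasure k r) P) (hpos : ∀ᵐ ω ∂P, 0 < I ω) (hK : 0 < K) (hr : 0 < r)
    (hL : ∀ s : ℝ, 0 < s →
      ∫⁻ ω, ENNReal.ofReal (Real.exp (-(s * I ω))) ∂P = ENNReal.ofReal (Real.exp (-(K * √s)))) :
    Integrable (fun ω => Real.log (1 + sinr S I 0 ω)) P ∧
      ∫ ω, Real.log (1 + sinr S I 0 ω) ∂P =
        ∑ i ∈ Finset.range k, (-1 : ℝ) ^ i / (i.factorial : ℝ) *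
          iteratedDeriv i (fun s => rateFun (K * √(r * s))) 1 := by
  have hm := measurable_sinr hS hI 0
  have hγ := ae_sinr_zero_pos hk hr hS hI h hlaw hpos
  obtain ⟨hTi, hTv⟩ := integral_erlangTail_prod_rateMeasure hI hK hr hL k
  have hTm : Measurable fun z : Ω × ℝ => ENNReal.ofReal (erlangTail k (r * (z.2 * I z.1))) :=
    ((continuous_erlangTail k).measurable.comp (by fun_prop)).ennreal_ofReal
  have hTnn : 0 ≤ᵐ[P.prod rateMeasure] fun z : Ω × ℝ => erlangTail k (r * (z.2 * I z.1)) := by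
    have h1 : ∀ᵐ z ∂(P.prod rateMeasure), 0 < I z.1 :=
      Measure.quasiMeasurePreserving_fst.ae hpos
    have h2 : ∀ᵐ z ∂(P.prod rateMeasure), 0 < z.2 := by
      refine Measure.quasiMeasurePreserving_snd.ae (p := fun t : ℝ => 0 < t) ?_
      exact (withDensity_absolutelyContinuous _ _).ae_le (ae_restrict_mem measurableSet_Ioi)
    filter_upwards [h1, h2] with z hz1 hz2
    exact erlangTail_nonneg k (by positivity)
  -- Layer cake with weight `1/(1 + t)`, the derivative of `log(1 + t)`; the tail of the ratio is
  -- the mean of `erlangTail`.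
  have hlin : ∫⁻ ω, ENNReal.ofReal (Real.log (1 + sinr S I 0 ω)) ∂P =
      ENNReal.ofReal (∫ z, erlangTail k (r * (z.2 * I z.1)) ∂(P.prod rateMeasure)) := by
    have h1 := lintegral_comp_eq_lintegral_meas_lt_mul (f := sinr S I 0) (g := fun t => (1 + t)⁻¹) P
      (hγ.mono fun ω hω => hω.le) hm.aemeasurable (fun t ht => ?_) ?_
    · rw [ofReal_integral_eq_lintegral_ofReal hTi hTnn, lintegral_prod_symm _ hTm.aemeasurable,
        lintegral_rateMeasure hTm.lintegral_prod_left']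
      refine (lintegral_congr_ae ?_).trans (h1.trans ?_)
      · filter_upwards [hγ] with ω hω
        rw [integral_inv_one_add hω.le]
      · refine setLIntegral_congr_fun measurableSet_Ioi fun t ht => ?_
        rw [← measure_lt_sinr_zero hk hr hS hI h hlaw hpos (le_of_lt ht)]
    · refine ContinuousOn.intervalIntegrable (ContinuousOn.inv₀ (by fun_prop) fun x hx => ?_)
      rw [uIcc_of_le (le_of_lt ht)] at hx
      linarith [hx.1]
    · filter_upwards [ae_restrict_mem measurableSet_Ioi] with t ht
      have ht : 0 < t := ht
      positivity
  have hlm : Measurable fun ω => Real.log (1 + sinr S I 0 ω) := by fun_prop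
  have hlnn : 0 ≤ᵐ[P] fun ω => Real.log (1 + sinr S I 0 ω) :=
    hγ.mono fun ω hω => Real.log_nonneg (by linarith)
  constructor
  · refine ⟨hlm.aestronglyMeasurable, ?_⟩
    rw [hasFiniteIntegral_iff_ofReal hlnn, hlin]
    exact ENNReal.ofReal_lt_top
  · rw [integral_eq_lintegral_of_nonneg_ae hlnn hlm.aestronglyMeasurable, hlin,
      ENNReal.toReal_ofReal (integral_nonneg_of_ae hTnn), hTv]

/-- Transfers the expectation to the density. Restricting to `(0, ∞)` loses nothing because `γ` is
almost surely positive. -/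
lemma rateWellDefined_and_averageRate_eq {γ : Ω → ℝ} (hpdf : HasPDF γ P volume)
    (hpos : ∀ᵐ ω ∂P, 0 < γ ω) (hint : Integrable (fun ω => Real.log (1 + γ ω)) P) :
    RateWellDefined γ P ∧
      averageRate γ P = 1 / Real.log 2 * ∫ ω, Real.log (1 + γ ω) ∂P := by
  set f : ℝ → ℝ := (Ioi (0 : ℝ)).indicator fun x => Real.logb 2 (1 + x) with hf
  have hfm : Measurable f := by
    refine Measurable.indicator ?_ measurableSet_Ioi
    unfold Real.logb
    fun_prop
  have hae : (fun ω => f (γ ω)) =ᵐ[P] fun ω => 1 / Real.log 2 * Real.log (1 + γ ω) := by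
    filter_upwards [hpos] with ω hω
    rw [hf, indicator_of_mem (mem_Ioi.2 hω), Real.logb]
    ring
  have hind : (fun x => (pdf γ P volume x).toReal • f x) =
      (Ioi (0 : ℝ)).indicator fun x => Real.logb 2 (1 + x) * (pdf γ P volume x).toReal := by
    ext x
    by_cases hx : x ∈ Ioi (0 : ℝ)
    · rw [hf, indicator_of_mem hx, indicator_of_mem hx, smul_eq_mul, mul_comm]
    · rw [hf, indicator_of_notMem hx, indicator_of_notMem hx, smul_zero]
  have hi : Integrable (fun x => (pdf γ P volume x).toReal • f x) volume :=
    (pdf.integrable_pdf_smul_iff hfm.aestronglyMeasurable).2 ((hint.const_mul _).congr hae.symm)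
  have hv : ∫ x, (pdf γ P volume x).toReal • f x = ∫ ω, f (γ ω) ∂P :=
    pdf.integral_pdf_smul hfm.aestronglyMeasurable
  rw [hind] at hi hv
  rw [integrable_indicator_iff measurableSet_Ioi] at hi
  rw [integral_indicator measurableSet_Ioi, integral_congr_ae hae, integral_const_mul] at hv
  exact ⟨⟨hpdf, hpos, hi⟩, hv⟩

end Rate

end Ratio

/-! ### Positivity of the fitted scale -/

/-- Log-convexity of Gamma at the midpoint of `m` and `m + 1`, together with `Γ(m + 1) = m Γ(m)`. -/
lemma gamma_add_half_div_le {m : ℝ} (hm : 0 < m) :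
    Real.Gamma (m + 1 / 2) / Real.Gamma m ≤ √m := by
  have hG := Real.Gamma_pos_of_pos hm
  have h := Real.Gamma_mul_add_mul_le_rpow_Gamma_mul_rpow_Gamma hm (by linarith : 0 < m + 1)
    (a := 1 / 2) (b := 1 / 2) (by norm_num) (by norm_num) (by norm_num)
  have h1 : (1 / 2 : ℝ) * m + 1 / 2 * (m + 1) = m + 1 / 2 := by ring
  rw [h1, Real.Gamma_add_one hm.ne', ← Real.sqrt_eq_rpow, ← Real.sqrt_eq_rpow,
    Real.sqrt_mul hm.le, mul_left_comm, Real.mul_self_sqrt hG.le] at h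
  rwa [div_le_iff₀ hG]

namespace Params

variable (θ : Params)

lemma meanHR_pos : 0 < θ.meanHR := by
  have h1 := Real.Gamma_pos_of_pos θ.mh_pos
  have h2 := Real.Gamma_pos_of_pos θ.mr_pos
  have h3 := Real.Gamma_pos_of_pos (by linarith [θ.mh_pos] : 0 < θ.mh + 1 / 2)
  have h4 := Real.Gamma_pos_of_pos (by linarith [θ.mr_pos] : 0 < θ.mr + 1 / 2)
  have h5 := θ.mh_pos
  have h6 := θ.mr_pos
  unfold meanHR
  positivity

lemma meanHR_le_one : θ.meanHR ≤ 1 := by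
  have h1 := Real.Gamma_pos_of_pos θ.mr_pos
  have h2 := Real.Gamma_pos_of_pos (by linarith [θ.mr_pos] : 0 < θ.mr + 1 / 2)
  have hh := θ.mh_pos
  have hr := θ.mr_pos
  calc θ.meanHR ≤ √θ.mh * √θ.mr * √(1 / (θ.mh * θ.mr)) := by
        unfold meanHR
        gcongr
        · exact gamma_add_half_div_le hh
        · exact gamma_add_half_div_le hr
    _ = 1 := by
        rw [← Real.sqrt_mul hh.le, ← Real.sqrt_mul (by positivity), mul_one_div_cancel (by positivity),
          Real.sqrt_one]

lemma meanSr_pos : 0 < θ.meanSr :=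
  mul_pos (Nat.cast_pos.2 θ.N_pos) θ.meanHR_pos

lemma secondSr_sub_sq_nonneg : 0 ≤ θ.secondSr - θ.meanSr ^ 2 := by
  have h1 : θ.secondSr - θ.meanSr ^ 2 = θ.N * (1 - θ.meanHR ^ 2) := by
    unfold secondSr meanSr
    ring
  rw [h1]
  have h2 := θ.meanHR_pos
  have h3 := θ.meanHR_le_one
  exact mul_nonneg (Nat.cast_nonneg _) (by nlinarith)

lemma kappaR_nonneg : 0 ≤ θ.kappaR := div_nonneg (sq_nonneg _) θ.secondSr_sub_sq_nonneg

lemma omegaR_nonneg : 0 ≤ θ.omegaR := div_nonneg θ.secondSr_sub_sq_nonneg θ.meanSr_pos.le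

/-- A ratio of Gammas is a rising factorial. The degenerate case `κ_r = 0` is covered by `Γ(0) = 0`
and division by zero, both sides vanishing for `q ≠ 0`. The weak bound `meanHR ≤ 1` therefore
suffices. -/
lemma muS_eq {q : ℕ} (hq : q ≠ 0) :
    θ.muS q = θ.omegaR ^ q * ∏ j ∈ Finset.range q, (θ.kappaR + j) := by
  unfold muS
  rcases θ.kappaR_nonneg.eq_or_lt with h | h
  · rw [← h, Real.Gamma_zero, div_zero, Finset.prod_eq_zero (Finset.mem_range.2 (Nat.pos_of_ne_zero hq))]
    · simp
    · simp
  · have hG : ∀ n : ℕ, Real.Gamma (n + θ.kappaR) =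
        (∏ j ∈ Finset.range n, (θ.kappaR + j)) * Real.Gamma θ.kappaR := fun n => by
      induction n with
      | zero => simp
      | succ n ih =>
        have h1 : ((n + 1 : ℕ) : ℝ) + θ.kappaR = (n + θ.kappaR) + 1 := by push_cast; ring
        rw [h1, Real.Gamma_add_one (by positivity), ih, Finset.prod_range_succ]
        ring
    rw [hG, mul_div_assoc, mul_div_assoc, div_self (Real.Gamma_pos_of_pos h).ne', mul_one]

lemma muG_one : muG 1 = √Real.pi / 2 := by
  have h1 : (1 : ℝ) + ((1 : ℕ) : ℝ) / 2 = 1 / 2 + 1 := by norm_num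
  rw [muG, h1, Real.Gamma_add_one (by norm_num), Real.Gamma_one_half_eq]
  ring

lemma muG_two : muG 2 = 1 := by
  have h1 : (1 : ℝ) + ((2 : ℕ) : ℝ) / 2 = 2 := by norm_num
  rw [muG, h1, Real.Gamma_two]

lemma chi1_eq : θ.chi1 = 1 + √Real.pi * (θ.beta * θ.omegaR) * θ.kappaR +
    (θ.beta * θ.omegaR) ^ 2 * (θ.kappaR * (θ.kappaR + 1)) := by
  rw [chi1, muG_one, muG_two, θ.muS_eq one_ne_zero, θ.muS_eq two_ne_zero]
  simp only [Finset.prod_range_succ, Finset.prod_range_zero, Finset.prod_range_one]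
  push_cast
  ring

lemma chi2_eq : θ.chi2 = 2 + 3 * √Real.pi * (θ.beta * θ.omegaR) * θ.kappaR +
    6 * (θ.beta * θ.omegaR) ^ 2 * (θ.kappaR * (θ.kappaR + 1)) +
    2 * √Real.pi * (θ.beta * θ.omegaR) ^ 3 * (θ.kappaR * (θ.kappaR + 1) * (θ.kappaR + 2)) +
    (θ.beta * θ.omegaR) ^ 4 *
      (θ.kappaR * (θ.kappaR + 1) * (θ.kappaR + 2) * (θ.kappaR + 3)) := by
  have g3 : muG 3 = 3 * √Real.pi / 4 := by
    have h1 : (1 : ℝ) + ((3 : ℕ) : ℝ) / 2 = 1 / 2 + 1 + 1 := by norm_num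
    rw [muG, h1, Real.Gamma_add_one (by norm_num), Real.Gamma_add_one (by norm_num),
      Real.Gamma_one_half_eq]
    ring
  have g4 : muG 4 = 2 := by
    have h1 : (1 : ℝ) + ((4 : ℕ) : ℝ) / 2 = 2 + 1 := by norm_num
    rw [muG, h1, Real.Gamma_add_one (by norm_num), Real.Gamma_two]
    norm_num
  rw [chi2, muG_one, muG_two, g3, g4, θ.muS_eq one_ne_zero, θ.muS_eq two_ne_zero, θ.muS_eq three_ne_zero,
    θ.muS_eq four_ne_zero]
  simp only [Finset.prod_range_succ, Finset.prod_range_zero, Finset.prod_range_one]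
  push_cast
  ring

lemma omegaS_pos : 0 < θ.omegaS := by
  have hk := θ.kappaR_nonneg
  have ht : 0 ≤ θ.beta * θ.omegaR := mul_nonneg (Real.sqrt_nonneg _) θ.omegaR_nonneg
  have hw := Real.sqrt_nonneg Real.pi
  have hw2 : √Real.pi ^ 2 ≤ 4 := by
    rw [Real.sq_sqrt Real.pi_pos.le]
    exact Real.pi_le_four
  have h1 : 0 < θ.chi1 := by
    rw [chi1_eq]
    positivity
  have h2 : 0 < θ.chi2 - θ.chi1 ^ 2 := by
    rw [chi1_eq, chi2_eq]
    set t := θ.beta * θ.omegaR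
    set κ := θ.kappaR
    set w := √Real.pi
    -- Expanding `χ₂ - χ₁²` in `t`, `κ` and `w`, the only coefficient not visibly nonnegative is
    -- that of `t²κ²`, namely `4 - π`. The constant term `1` makes the inequality strict.
    have h3 : 0 ≤ (4 - w ^ 2) * (t ^ 2 * κ ^ 2) :=
      mul_nonneg (sub_nonneg.2 hw2) (by positivity)
    have h4 : 0 < 1 + w * t * κ + 4 * t ^ 2 * κ + 4 * w * t ^ 3 * κ * (κ + 1) +
        t ^ 4 * κ * (κ + 1) * (4 * κ + 6) := by positivity
    linear_combination h3 + h4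
  exact mul_pos θ.etaG0_pos (div_pos h2 h1)

lemma kappaHat_pos : 0 < θ.kappaHat := lt_max_of_lt_left one_pos

lemma V1_eq (s : ℝ) : θ.V1 s = θ.laplaceCoeff * √(1 / θ.omegaS * s) := by
  have h1 : θ.e1 / θ.omegaS * s = θ.e1 * (1 / θ.omegaS * s) := by ring
  have h2 : θ.Cd / θ.omegaS * s = θ.Cd * (1 / θ.omegaS * s) := by ring
  rw [V1, h1, h2, Real.sqrt_mul θ.e1_pos.le, Real.sqrt_mul θ.Cd_pos.le, laplaceCoeff]
  ring

lemma V2_eq : θ.V2 = θ.laplaceCoeff * √(1 / θ.etaG0 * 1) := by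
  have h1 : θ.e1 / θ.etaG0 = θ.e1 * (1 / θ.etaG0 * 1) := by ring
  have h2 : θ.Cd / θ.etaG0 = θ.Cd * (1 / θ.etaG0 * 1) := by ring
  rw [V2, h1, h2, Real.sqrt_mul θ.e1_pos.le, Real.sqrt_mul θ.Cd_pos.le, laplaceCoeff]
  ring

lemma Vplus_eq : θ.Vplus = fun s => rateFun (θ.laplaceCoeff * √(1 / θ.omegaS * s)) := by
  ext s
  rw [Vplus, V1_eq]

end Params

/-! ### The average rate -/

lemma indepFun_interference {E : Type*} [MeasurableSpace E] {θ : Params}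
    {X : ℕ → Ω → Plane} {M : ℕ → Ω → Mark} {P : Measure Ω} {S : Ω → E}
    (h : IndepFun S (fun ω k => (X k ω, M k ω)) P) : IndepFun S (interference θ X M) P := by
  have h1 := h.comp measurable_id (measurable_configInterference θ)
  have h2 : configInterference θ ∘ (fun ω k => (X k ω, M k ω)) = interference θ X M := by
    ext ω
    rw [interference_eq_toReal]
    rfl
  rwa [h2] at h1

/-- The average rate of a signal with a gamma distributed power of integer shape. -/
lemma IsInterferers.averageRate_eq {θ : Params} (hα : θ.α = 4) {X : ℕ → Ω → Plane}
    {M : ℕ → Ω → Mark} {P : Measure Ω} [IsProbabilityMeasure P] (h : IsInterferers θ X M P)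
    {k : ℕ} (hk : 0 < k) {r : ℝ} (hr : 0 < r) {S : Ω → ℝ} (hS : Measurable S)
    (hlaw : HasLaw S (gammaMeasure k r) P) (hind : IndepFun S (interference θ X M) P) :
    RateWellDefined (sinr S (interference θ X M) 0) P ∧
      averageRate (sinr S (interference θ X M) 0) P =
        1 / Real.log 2 * ∑ i ∈ Finset.range k, (-1 : ℝ) ^ i / (i.factorial : ℝ) *
          iteratedDeriv i (fun s => rateFun (θ.laplaceCoeff * √(r * s))) 1 := by
  have hI := h.measurable_interference
  have hpos := h.ae_interference_pos hα
  have hac : P.map S ≪ volume := by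
    rw [hlaw.map_eq]
    exact withDensity_absolutelyContinuous _ _
  obtain ⟨hi, hv⟩ := integral_log_one_add_sinr hk hS hI hind hlaw hpos θ.laplaceCoeff_pos hr
    fun s hs => h.lintegral_exp_neg_interference hα hs
  rw [← hv]
  exact rateWellDefined_and_averageRate_eq (hasPDF_sinr_zero hS hI hind hac hpos)
    (ae_sinr_zero_pos hk hr hS hI hind hlaw hpos) hi

end RISNetwork

theorem mainTheorem9 (θ : RISNetwork.Params) (hα : θ.α = 4)
    {Ω : Type*} [MeasurableSpace Ω] (P : Measure Ω) [IsProbabilityMeasure P]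
    (X : ℕ → Ω → RISNetwork.Plane) (M : ℕ → Ω → RISNetwork.Mark)
    (hXM : RISNetwork.IsInterferers θ X M P)
    (S : Ω → ℝ) (hS_meas : Measurable S)
    (hS : HasLaw S (gammaMeasure (θ.kappaHat : ℝ) (1 / θ.omegaS)) P)
    (hS_indep : IndepFun S (fun ω k => (X k ω, M k ω)) P)
    (g : Ω → ℂ) (hg_meas : Measurable g)
    (hg : HasLaw g (RISNetwork.complexNormal 1) P)
    (hg_indep : IndepFun g (fun ω k => (X k ω, M k ω)) P) :
    (RISNetwork.RateWellDefined (RISNetwork.sinr S (RISNetwork.interference θ X M) 0) P ∧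
      ContDiffAt ℝ ((⊤ : ℕ∞) : WithTop ℕ∞) θ.Vplus 1 ∧
      RISNetwork.averageRate (RISNetwork.sinr S (RISNetwork.interference θ X M) 0) P =
        1 / Real.log 2 * ∑ i ∈ Finset.range θ.kappaHat,
          (-1 : ℝ) ^ i / (i.factorial : ℝ) * iteratedDeriv i θ.Vplus 1) ∧
    (RISNetwork.RateWellDefined
        (RISNetwork.sinr (RISNetwork.signalDirect θ g) (RISNetwork.interference θ X M) 0) P ∧
      RISNetwork.averageRate
          (RISNetwork.sinr (RISNetwork.signalDirect θ g) (RISNetwork.interference θ X M) 0) P =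
        1 / Real.log 2 * ((Real.pi - 2 * RISNetwork.sinInt θ.V2) * Real.sin θ.V2 -
          2 * RISNetwork.cosInt θ.V2 * Real.cos θ.V2)) := by
  have hη := θ.etaG0_pos
  have hω := θ.omegaS_pos
  have hI := hXM.measurable_interference
  obtain ⟨hw1, hr1⟩ := hXM.averageRate_eq hα θ.kappaHat_pos (one_div_pos.2 hω) hS_meas hS
    (RISNetwork.indepFun_interference hS_indep)
  have hg_pow : Measurable fun z : ℂ => θ.etaG0 * ‖z‖ ^ 2 := by fun_prop
  have hlaw : HasLaw (RISNetwork.signalDirect θ g)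
      (gammaMeasure ((1 : ℕ) : ℝ) (1 / θ.etaG0)) P := by
    rw [Nat.cast_one]
    exact RISNetwork.hasLaw_signalDirect θ hg
  -- The exponential signal is gamma of shape `1`, so the derivative sum reduces to its zeroth term.
  obtain ⟨hw2, hr2⟩ := hXM.averageRate_eq hα one_pos (one_div_pos.2 hη)
    (S := RISNetwork.signalDirect θ g) (hg_pow.comp hg_meas) hlaw
    ((RISNetwork.indepFun_interference hg_indep).comp hg_pow measurable_id)
  refine ⟨⟨hw1, ?_, ?_⟩, hw2, ?_⟩
  · rw [θ.Vplus_eq]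
    exact RISNetwork.contDiffAt_rateFun hI θ.laplaceCoeff_pos (one_div_pos.2 hω)
      (fun s hs => hXM.lintegral_exp_neg_interference hα hs) _
  · rw [hr1, θ.Vplus_eq]
  · rw [hr2]
    simp only [Finset.sum_range_one, pow_zero, Nat.factorial_zero, Nat.cast_one, div_one, one_mul,
      iteratedDeriv_zero]
    rw [← θ.V2_eq]
    rfl
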